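/- Let $\lambda\in\mathbb C$ with $\beta=\operatorname{Im}\lambda>0$, and let $u\not\equiv 0$ be an entire function with $$u''(z)-iz^3u(z)=-\lambda u(z)\qquad(z\in\mathbb C)$$ which is an eigenfunction with eigenvalue $\lambda$, that is, $u(re^{i\theta})\to 0$ as $r\to+\infty$ for every $\theta$ in the right-hand Stokes region $-\frac{3\pi}{10}<\theta<\frac{\pi}{10}$ and for every $\theta$ in the left-hand Stokes region $\frac{9\pi}{10}<\theta<\frac{13\pi}{10}$. Let $$A_1=\{z:\operatorname{Im}z>0,\ \operatorname{Re}(iz^3-\lambda)>0\},\qquad B_2=\{z:\operatorname{Re}z<0,\ \operatorname{Im}z>0,\ \operatorname{Im}(iz^3-\lambda)>0\},$$ and $B_2^c=\mathbb C\setminus B_2$. Then: (i) $\operatorname{Re}(u'\bar u)\ge 0$ at some point of the imaginary axis if and only if $uu'$ has infinitely many zeros in $A_1\cap B_2$ and at most finitely many zeros in $A_1\cap B_2^c$. (ii) $\operatorname{Re}(u'\bar u)<0$ at every point of the imaginary axis if and only if $uu'$ has no zeros in $\{z\in A_1:\operatorname{Re}z\le 0\}$ and infinitely many zeros in $\{z\in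 A_1:\operatorname{Re}z>0\}$. -/

import Mathlib

noncomputable section

namespace CubicOscillator

open Filter Topology

/-- The directions `θ_j = (2πj + π/2)/5` of the critical rays of `u'' = (i z³ - λ) u`. -/
def criticalAngle (j : ℤ) : ℝ := (2 * Real.pi * j + Real.pi / 2) / 5

/-- `u` decays to zero along every ray to infinity in the open sector (Stokes region)
`θ_j < arg z < θ_{j+1}`. -/
def DecaysInStokesRegion (u : ℂ → ℂ) (j : ℤ) : Prop :=
  ∀ θ : ℝ, criticalAngle j < θ → θ < criticalAngle (j + 1) →
    Tendsto (fun r : ℝ => u ((r : ℂ) * Complex.exp ((θ : ℂ) * Complex.I))) atTop (𝓝 0)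

/-- `u` is an eigenfunction with eigenvalue `lam`: a nonzero entire solution of
`u'' - i z³ u = - lam u` which decays to zero in the two Stokes regions containing the positive
and the negative real axis. -/
structure IsEigenfunction (lam : ℂ) (u : ℂ → ℂ) : Prop where
  entire : Differentiable ℂ u
  ne_zero : ∃ z, u z ≠ 0
  ode : ∀ z, deriv (deriv u) z - Complex.I * z ^ 3 * u z = - lam * u z
  /-- Right-hand Stokes region `-3π/10 < arg z < π/10`. -/
  decay_right : DecaysInStokesRegion u (-1)
  /-- Left-hand Stokes region `9π/10 < arg z < 13π/10`. -/
  decay_left : DecaysInStokesRegion u 2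

/-- The component of `{Re (i z³ - lam) > 0}` in the upper half-plane; for `Re lam > 0` (which holds
for every eigenvalue) that set has three components, one in the upper half-plane and one in each
of the two lower quadrants. -/
def regionA₁ (lam : ℂ) : Set ℂ :=
  {z | 0 < z.im ∧ 0 < (Complex.I * z ^ 3 - lam).re}

/-- The component of `{Im (i z³ - lam) > 0}` in the second quadrant; for `Im lam > 0` that set has
three components, one around the positive real axis, one in the second quadrant and one in the
third quadrant. -/
def regionB₂ (lam : ℂ) : Set ℂ :=
  {z | z.re < 0 ∧ 0 < z.im ∧ 0 < (Complex.I * z ^ 3 - lam).im}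

/-- `Re (u' ū)` at the point `z`. -/
def reDerivConj (u : ℂ → ℂ) (z : ℂ) : ℝ :=
  (deriv u z * (starRingEnd ℂ) (u z)).re

/-- The zeros of `u u'` that lie in `S`. -/
def zerosIn (u : ℂ → ℂ) (S : Set ℂ) : Set ℂ :=
  {z | z ∈ S ∧ u z * deriv u z = 0}

end CubicOscillator

end

noncomputable section

namespace CubicOscillator

open Filter Topology ComplexConjugate

/-! Write q = iz³ - λ, so u'' = qu, and g = Re(u'ū), which vanishes at every zero of uu'. Two
monotonicity laws govern g. Along horizontal lines dg/dx = |u'|² + Re q |u|², so g increases to the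
right inside A₁. On the imaginary axis Re q' terms do not enter: dg/dy = Im λ |u|², so g is strictly
increasing upwards.

If g < 0 on the whole axis, moving left from the axis inside A₁ keeps g negative, which excludes
zeros with Re z ≤ 0 (`zeros_left_empty`). If g ≥ 0 somewhere on the axis, then g ≥ δ > 0 higher up,
and moving right keeps it positive. To the left of the axis, the points of A₁ outside B₂ satisfy |Re
z| ≤ Im λ / y², where y = Im z. On the axis the energy |u'|² + y³|u|² is O(y^(7/4)), so over that
distance g can drop only by O(y^(-1/4)); hence only boundedly many heights can carry zeros there
(`finite_zeros_compl`).

Both equivalences then follow from one more fact, `infinite_zeros_regionA₁`: A₁ contains infinitely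
many zeros. Suppose not. With z = iw² the potential is w⁶ - λ, and u(iw² + ζ/w³) nearly solves f'' =
f on a fixed disc. If both exponentials were present in comparable size there would be a zero, so
u'/u is close to σw³, with one sign σ by connectedness. Whichever sign occurs, u is bounded on a ray
of A₁, to the left or to the right of the imaginary axis. After a reflection the ray is on the left.
Phragmén–Lindelöf spreads this bound across a sector reaching into the left Stokes region, where u
decays faster than every Gaussian; this forces u = 0 (`unbounded_on_ray`). -/

/-! ### Derivatives of sesquilinear quantities along lines. -/

lemma hasDerivAt_along_line {F : ℂ → ℂ} {F' a b : ℂ} {t : ℝ}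
    (hF : HasDerivAt F F' (a + t * b)) :
    HasDerivAt (fun s : ℝ => F (a + s * b)) (b * F') t := by
  have h : HasDerivAt (fun s : ℝ => a + (s : ℂ) * b) b t := by
    simpa using ((Complex.ofRealCLM.hasDerivAt (x := t)).mul_const b).const_add a
  rw [mul_comm]
  exact HasDerivAt.comp t hF h

lemma hasDerivAt_re_mul_conj {f g : ℝ → ℂ} {f' g' : ℂ} {t : ℝ}
    (hf : HasDerivAt f f' t) (hg : HasDerivAt g g' t) :
    HasDerivAt (fun s => (f s * conj (g s)).re) ((f' * conj (g t)).re + (f t * conj g').re) t := by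
  have h := hf.mul hg.star
  have h' : HasDerivAt (fun s => (f s * conj (g s)).re) _ t :=
    Complex.reCLM.hasFDerivAt.comp_hasDerivAt t h
  exact h'.congr_deriv (by simp)

lemma hasDerivAt_norm_sq {f : ℝ → ℂ} {f' : ℂ} {t : ℝ} (hf : HasDerivAt f f' t) :
    HasDerivAt (fun s => ‖f s‖ ^ 2) (2 * (f' * conj (f t)).re) t := by
  have h := hasDerivAt_re_mul_conj hf hf
  have e : (fun s => ‖f s‖ ^ 2) = fun s => (f s * conj (f s)).re := by
    funext s
    rw [Complex.mul_conj, Complex.ofReal_re, Complex.normSq_eq_norm_sq]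
  rw [e]
  convert h using 1
  simp only [Complex.mul_re, Complex.conj_re, Complex.conj_im]
  ring

lemma re_mul_conj_le (a b : ℂ) : |(a * conj b).re| ≤ ‖a‖ * ‖b‖ := by
  simpa using Complex.abs_re_le_norm (a * conj b)

/-! ### The equation along lines, isolated zeros, and Re λ > 0. -/

namespace IsEigenfunction

variable {lam : ℂ} {u : ℂ → ℂ}

lemma hasDerivAt (hu : IsEigenfunction lam u) (z : ℂ) : HasDerivAt u (deriv u z) z :=
  (hu.entire z).hasDerivAt

lemma differentiable_deriv (hu : IsEigenfunction lam u) : Differentiable ℂ (deriv u) :=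
  hu.entire.deriv

lemma hasDerivAt_deriv (hu : IsEigenfunction lam u) (z : ℂ) :
    HasDerivAt (deriv u) ((Complex.I * z ^ 3 - lam) * u z) z := by
  have h := (hu.differentiable_deriv z).hasDerivAt
  have e : deriv (deriv u) z = (Complex.I * z ^ 3 - lam) * u z := by
    linear_combination hu.ode z
  rwa [e] at h

/-- Together with `hasDerivAt_re_line` this gives the second derivative of |u|² along any line. The
sign of Re(b²q) decides convexity, which is the source of every decay or monotonicity argument
below. -/
lemma hasDerivAt_norm_sq_line (hu : IsEigenfunction lam u) (a b : ℂ) (t : ℝ) :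
    HasDerivAt (fun s : ℝ => ‖u (a + s * b)‖ ^ 2)
      (2 * (b * deriv u (a + t * b) * conj (u (a + t * b))).re) t :=
  hasDerivAt_norm_sq (hasDerivAt_along_line (hu.hasDerivAt _))

lemma hasDerivAt_re_line (hu : IsEigenfunction lam u) (a b : ℂ) (t : ℝ) :
    HasDerivAt (fun s : ℝ => (b * deriv u (a + s * b) * conj (u (a + s * b))).re)
      (‖b‖ ^ 2 * ‖deriv u (a + t * b)‖ ^ 2 +
        (b ^ 2 * (Complex.I * (a + t * b) ^ 3 - lam)).re * ‖u (a + t * b)‖ ^ 2) t := by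
  have h := hasDerivAt_re_mul_conj
    ((hasDerivAt_along_line (a := a) (b := b) (t := t) (hu.hasDerivAt_deriv _)).const_mul b)
    (hasDerivAt_along_line (a := a) (b := b) (t := t) (hu.hasDerivAt _))
  convert h using 1
  simp only [← Complex.normSq_eq_norm_sq, Complex.normSq_apply]
  simp only [map_mul, Complex.mul_re, Complex.mul_im, Complex.conj_re, Complex.conj_im, pow_two]
  ring

lemma analyticOnNhd (hu : IsEigenfunction lam u) : AnalyticOnNhd ℂ u Set.univ :=
  fun z _ => hu.entire.analyticAt z

lemma frequently_zero_absurd (hu : IsEigenfunction lam u) {z : ℂ}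
    (h : ∃ᶠ w in 𝓝[≠] z, u w = 0) : False := by
  obtain ⟨w, hw⟩ := hu.ne_zero
  exact hw (hu.analyticOnNhd.eqOn_zero_of_preconnected_of_frequently_eq_zero
    isPreconnected_univ (Set.mem_univ z) h (Set.mem_univ w))

/-- An eigenfunction cannot vanish on a nontrivial piece of a line. -/
lemma exists_ne_zero_on_line (hu : IsEigenfunction lam u) (a : ℂ) {b : ℂ} (hb : b ≠ 0)
    {s t : ℝ} (hst : s < t) : ∃ x ∈ Set.Ioo s t, u (a + x * b) ≠ 0 := by
  by_contra! H
  set m := (s + t) / 2 with hm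
  have hms : s < m := by rw [hm]; linarith
  have hmt : m < t := by rw [hm]; linarith
  apply hu.frequently_zero_absurd (z := a + m * b)
  have htd : Tendsto (fun x : ℝ => a + (x : ℂ) * b) (𝓝[≠] m) (𝓝[≠] (a + m * b)) := by
    apply tendsto_nhdsWithin_of_tendsto_nhds_of_eventually_within
    · apply Tendsto.mono_left _ nhdsWithin_le_nhds
      apply Continuous.tendsto
      fun_prop
    · filter_upwards [self_mem_nhdsWithin] with x hx h
      apply hx
      have h2 : (x : ℂ) * b = m * b := add_left_cancel h
      exact_mod_cast mul_right_cancel₀ hb h2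
  apply htd.frequently
  apply Eventually.frequently
  filter_upwards [nhdsWithin_le_nhds (Ioo_mem_nhds hms hmt)] with x hx using H x hx

/-- If u' vanished identically, the equation would give qu = 0, and analytic functions on ℂ have no
zero divisors. -/
lemma deriv_not_frequently_zero (hu : IsEigenfunction lam u) {z : ℂ} :
    ¬ ∃ᶠ w in 𝓝[≠] z, deriv u w = 0 := by
  intro h
  have hd : AnalyticOnNhd ℂ (deriv u) Set.univ := fun z _ => hu.differentiable_deriv.analyticAt z
  have h0 := hd.eqOn_zero_of_preconnected_of_frequently_eq_zero isPreconnected_univ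
    (Set.mem_univ z) h
  have hu0 : ∀ w : ℂ, (Complex.I * w ^ 3 - lam) * u w = 0 := by
    intro w
    have h1 := hu.hasDerivAt_deriv w
    have e : deriv u = fun _ => 0 := funext fun x => h0 (Set.mem_univ x)
    rw [e] at h1
    exact h1.unique (hasDerivAt_const w 0)
  have hq : AnalyticOnNhd ℂ (fun w : ℂ => Complex.I * w ^ 3 - lam) Set.univ :=
    fun w _ => Differentiable.analyticAt (by fun_prop) w
  rcases hq.eq_zero_or_eq_zero_of_mul_eq_zero hu.analyticOnNhd (fun w _ => hu0 w)
    isPreconnected_univ with h2 | h2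
  · have h3 := h2 0 (Set.mem_univ _)
    have h4 := h2 1 (Set.mem_univ _)
    simp at h3
    simp [h3] at h4
  · obtain ⟨w, hw⟩ := hu.ne_zero
    exact hw (h2 w (Set.mem_univ _))

lemma finite_zerosIn_of_bounded (hu : IsEigenfunction lam u) {S : Set ℂ}
    (hS : Bornology.IsBounded S) : (zerosIn u S).Finite := by
  by_contra hinf
  obtain ⟨R, hR⟩ := hS.subset_closedBall 0
  obtain ⟨z, -, hz⟩ := Set.Infinite.exists_accPt_of_subset_isCompact hinf
    (isCompact_closedBall (0 : ℂ) R) (fun w hw => hR hw.1)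
  rw [accPt_iff_frequently_nhdsNE] at hz
  have h1 : ∃ᶠ w in 𝓝[≠] z, u w = 0 ∨ deriv u w = 0 :=
    hz.mono fun w hw => mul_eq_zero.1 hw.2
  rcases frequently_or_distrib.1 h1 with h | h
  · exact hu.frequently_zero_absurd h
  · exact hu.deriv_not_frequently_zero h

lemma tendsto_pos_real (hu : IsEigenfunction lam u) :
    Tendsto (fun x : ℝ => u x) atTop (𝓝 0) := by
  have h := hu.decay_right 0 (by unfold criticalAngle; push_cast; linarith [Real.pi_pos])
    (by unfold criticalAngle; push_cast; linarith [Real.pi_pos])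
  simpa using h

lemma tendsto_neg_real (hu : IsEigenfunction lam u) :
    Tendsto (fun x : ℝ => u (-x)) atTop (𝓝 0) := by
  have h := hu.decay_left Real.pi (by unfold criticalAngle; push_cast; linarith [Real.pi_pos])
    (by unfold criticalAngle; push_cast; linarith [Real.pi_pos])
  simpa using h

/-- On the real axis ix³ is imaginary, so Re q = -Re λ. If Re λ ≤ 0 then |u|² is convex there and
tends to zero at both ends, hence vanishes. -/
lemma re_pos (hu : IsEigenfunction lam u) : 0 < lam.re := by
  by_contra! hneg
  set f : ℝ → ℝ := fun s => ‖u (0 + s * 1)‖ ^ 2 with hf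
  have h1 := hu.hasDerivAt_norm_sq_line 0 1
  have h2 := hu.hasDerivAt_re_line 0 1
  have hmono : Monotone (deriv f) := by
    have e : deriv f = fun s : ℝ => 2 * (1 * deriv u (0 + s * 1) * conj (u (0 + s * 1))).re :=
      funext fun s => (h1 s).deriv
    rw [e]
    apply monotone_of_hasDerivAt_nonneg (fun s => (h2 s).const_mul 2)
    intro s
    have : (1 ^ 2 * (Complex.I * (0 + (s : ℂ) * 1) ^ 3 - lam)).re = - lam.re := by
      rw [one_pow, one_mul, zero_add, mul_one, ← Complex.ofReal_pow, Complex.sub_re,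
        Complex.I_mul_re, Complex.ofReal_im, neg_zero, zero_sub]
    simp only [this, Pi.zero_apply]
    have := sq_nonneg ‖u (0 + (s : ℂ) * 1)‖
    have := mul_nonneg (neg_nonneg.2 hneg) this
    positivity
  have hconv : ConvexOn ℝ Set.univ f :=
    hmono.convexOn_univ_of_deriv fun s => (h1 s).differentiableAt
  have htop : Tendsto (fun x : ℝ => f x) atTop (𝓝 0) := by
    have := (hu.tendsto_pos_real.norm.pow 2)
    simpa [hf] using this
  have hbot : Tendsto (fun x : ℝ => f (-x)) atTop (𝓝 0) := by
    have := (hu.tendsto_neg_real.norm.pow 2)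
    simpa [hf] using this
  obtain ⟨x, -, hx⟩ := hu.exists_ne_zero_on_line 0 one_ne_zero zero_lt_one
  have hpos : 0 < f x := by positivity
  obtain ⟨t, ht1, ht2, ht3⟩ := ((htop.eventually_lt_const hpos).and
    ((hbot.eventually_lt_const hpos).and (eventually_gt_atTop |x|))).exists
  have hseg : x ∈ segment ℝ (-t) t := by
    rw [segment_eq_Icc (by linarith [abs_nonneg x])]
    exact abs_le.1 ht3.le
  have := hconv.le_on_segment (Set.mem_univ _) (Set.mem_univ _) hseg
  exact absurd this (not_le.2 (max_lt ht2 ht1))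

end IsEigenfunction

/-! ### Growth of order three, and decay beyond every Gaussian. -/

/-- A multiplicative Grönwall inequality. -/
lemma le_mul_exp_of_deriv_le {f f' φ φ' : ℝ → ℝ} {a b : ℝ} (hab : a ≤ b)
    (hf : ∀ t ∈ Set.Icc a b, HasDerivAt f (f' t) t)
    (hφ : ∀ t ∈ Set.Icc a b, HasDerivAt φ (φ' t) t)
    (h : ∀ t ∈ Set.Icc a b, f' t ≤ φ' t * f t) : f b ≤ f a * Real.exp (φ b - φ a) := by
  have hd : ∀ t ∈ Set.Icc a b, HasDerivAt (fun t => f t * Real.exp (-φ t))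
      (f' t * Real.exp (-φ t) + f t * (Real.exp (-φ t) * (-φ' t))) t :=
    fun t ht => (hf t ht).mul (hφ t ht).neg.exp
  have hanti : AntitoneOn (fun t => f t * Real.exp (-φ t)) (Set.Icc a b) := by
    apply antitoneOn_of_deriv_nonpos (convex_Icc a b)
    · exact fun t ht => (hd t ht).continuousAt.continuousWithinAt
    · exact fun t ht => (hd t (interior_subset ht)).differentiableAt.differentiableWithinAt
    · intro t ht
      have ht' := interior_subset ht
      rw [(hd t ht').deriv]
      have e := Real.exp_pos (-φ t)
      nlinarith [h t ht']
  have h1 := hanti (Set.left_mem_Icc.2 hab) (Set.right_mem_Icc.2 hab) hab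
  have e : f b = f b * Real.exp (-φ b) * Real.exp (φ b) := by
    rw [mul_assoc, ← Real.exp_add]; simp
  rw [e, show φ b - φ a = -φ a + φ b by ring, Real.exp_add, ← mul_assoc]
  exact mul_le_mul_of_nonneg_right h1 (Real.exp_pos _).le

/-- The second-derivative test makes x a local minimum as well, so D is locally constant and its
second derivative is zero. -/
lemma isLocalMax_deriv2_pos_absurd {D D' : ℝ → ℝ} {d x : ℝ} (h1 : ∀ r, HasDerivAt D (D' r) r)
    (h2 : HasDerivAt D' d x) (hmax : IsLocalMax D x) (hd : 0 < d) : False := by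
  have e : deriv D = D' := funext fun r => (h1 r).deriv
  have h0 : deriv D x = 0 := hmax.deriv_eq_zero
  have hmin : IsLocalMin D x := by
    apply isLocalMin_of_deriv_deriv_pos _ h0 (h1 x).continuousAt
    rw [e, h2.deriv]; exact hd
  have hc : D =ᶠ[𝓝 x] fun _ => D x := by
    filter_upwards [hmax, hmin] with y hy1 hy2 using le_antisymm hy1 hy2
  have hderiv2 := hc.deriv.deriv_eq
  rw [e, h2.deriv] at hderiv2
  simp at hderiv2
  exact hd.ne' hderiv2

/-- A nonnegative function tending to zero with `f'' ≥ k r³ f` decays faster than every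
Gaussian. -/
lemma gaussian_bound_of_convexity {f f' f'' : ℝ → ℝ} {k R : ℝ} (hk : 0 < k)
    (h1 : ∀ r, HasDerivAt f (f' r) r) (h2 : ∀ r, HasDerivAt f' (f'' r) r)
    (h0 : ∀ r, 0 ≤ f r) (hf : ∀ r, R ≤ r → k * r ^ 3 * f r ≤ f'' r)
    (hlim : Tendsto f atTop (𝓝 0)) {n : ℝ} (hn : 0 < n) :
    ∃ A S : ℝ, ∀ r, S ≤ r → f r ≤ A * Real.exp (-(n * r ^ 2)) := by
  -- The comparison function h = A exp(-nr²) has h'' = (4n²r² - 2n)h, which is at most kr³h once r ≥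
  -- 4n²/k. So f - h has positive second derivative wherever it is positive and cannot have a
  -- positive interior maximum. The `+ 1` in `A` makes f - h negative at S.
  set S := max R (max 1 (4 * n ^ 2 / k)) with hS
  have hS1 : 1 ≤ S := le_trans (le_max_left _ _) (le_max_right _ _)
  have hSR : R ≤ S := le_max_left _ _
  have hSn : 4 * n ^ 2 / k ≤ S := le_trans (le_max_right _ _) (le_max_right _ _)
  set A := f S * Real.exp (n * S ^ 2) + 1 with hA
  have hApos : 0 < A := by have := h0 S; positivity
  refine ⟨A, S, ?_⟩
  by_contra! H
  obtain ⟨r, hr, hlt⟩ := H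
  set h : ℝ → ℝ := fun r => A * Real.exp (-(n * r ^ 2)) with hh
  have hh1 : ∀ r, HasDerivAt h (-(2 * n * r) * h r) r := by
    intro r
    have := ((((hasDerivAt_pow 2 r).const_mul n).neg.exp).const_mul A)
    refine (this : HasDerivAt h _ r).congr_deriv ?_
    simp [hh]; ring
  have hh2 : ∀ r, HasDerivAt (fun r => -(2 * n * r) * h r)
      ((4 * n ^ 2 * r ^ 2 - 2 * n) * h r) r := by
    intro r
    have := (((hasDerivAt_id r).const_mul (2 * n)).neg).mul (hh1 r)
    refine (this : HasDerivAt (fun r => -(2 * n * r) * h r) _ r).congr_deriv ?_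
    simp; ring
  have hhpos : ∀ r, 0 < h r := fun r => by positivity
  have hhlim : Tendsto h atTop (𝓝 0) := by
    have : Tendsto (fun r : ℝ => n * r ^ 2) atTop atTop :=
      (tendsto_pow_atTop two_ne_zero).const_mul_atTop hn
    simpa [hh] using (Real.tendsto_exp_neg_atTop_nhds_zero.comp this).const_mul A
  set D : ℝ → ℝ := fun r => f r - h r with hD
  have hDr : 0 < D r := sub_pos.2 hlt
  have hDlim : Tendsto D atTop (𝓝 0) := by simpa using hlim.sub hhlim
  obtain ⟨T, hT1, hT2⟩ := ((hDlim.eventually_lt_const hDr).and (eventually_gt_atTop r)).exists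
  have hDS : D S < 0 := by
    have : h S = f S + Real.exp (-(n * S ^ 2)) := by
      simp only [hh, hA, add_mul, one_mul, mul_assoc, ← Real.exp_add]
      simp
    simp only [hD, this]
    linarith [Real.exp_pos (-(n * S ^ 2))]
  have hD1 : ∀ r, HasDerivAt D (f' r - -(2 * n * r) * h r) r := fun r => (h1 r).sub (hh1 r)
  obtain ⟨x, hx, hmax⟩ := isCompact_Icc.exists_isMaxOn (Set.nonempty_Icc.2 (hr.trans hT2.le))
    (f := D) (fun r _ => (hD1 r).continuousAt.continuousWithinAt)
  have hDx : D r ≤ D x := hmax ⟨hr, hT2.le⟩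
  have hxS : S < x := by
    rcases hx.1.lt_or_eq with h | h
    · exact h
    · rw [← h] at hDx; linarith
  have hxT : x < T := by
    rcases hx.2.lt_or_eq with h | h
    · exact h
    · rw [h] at hDx; linarith
  refine isLocalMax_deriv2_pos_absurd hD1 ((h2 x).sub (hh2 x))
    (hmax.isLocalMax (Icc_mem_nhds hxS hxT)) ?_
  have hx0 : 0 < x := by linarith
  have hfx : h x < f x := by have : 0 < D x := by linarith
                             simpa [hD] using this
  have hkx : 4 * n ^ 2 ≤ k * x := by
    rw [div_le_iff₀ hk] at hSn
    nlinarith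
  have e1 : k * x ^ 3 * h x < k * x ^ 3 * f x := by
    apply mul_lt_mul_of_pos_left hfx; positivity
  have e2 : (4 * n ^ 2 * x ^ 2 - 2 * n) * h x ≤ k * x ^ 3 * h x := by
    apply mul_le_mul_of_nonneg_right _ (hhpos x).le
    nlinarith [sq_nonneg x]
  linarith [hf x (by linarith)]

lemma hasDerivAt_one_add_pow (k : ℕ) (t : ℝ) :
    HasDerivAt (fun s : ℝ => (1 + s) ^ k) (k * (1 + t) ^ (k - 1)) t := by
  refine (((hasDerivAt_id t).const_add 1).pow k).congr_deriv ?_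
  simp

namespace IsEigenfunction

variable {lam : ℂ} {u : ℂ → ℂ}

/-- Grönwall for |u'|² + (1+r)⁴|u|². The weight exceeds the natural r³; it costs some sharpness in
the order but keeps integer powers, as 2(1+r)²|u||u'| is bounded by this energy. -/
lemma norm_sq_le_exp (hu : IsEigenfunction lam u) {b : ℂ} (hb : ‖b‖ = 1) {r : ℝ} (hr : 0 ≤ r) :
    ‖u (0 + r * b)‖ ^ 2 ≤ (‖deriv u 0‖ ^ 2 + ‖u 0‖ ^ 2) *
      Real.exp ((6 + ‖lam‖) / 3 * (1 + r) ^ 3 - (6 + ‖lam‖) / 3) := by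
  have hE : ∀ t : ℝ, HasDerivAt (fun s : ℝ => ‖deriv u (0 + s * b)‖ ^ 2 +
      (1 + s) ^ 4 * ‖u (0 + s * b)‖ ^ 2) _ t := fun t =>
    (hasDerivAt_norm_sq (hasDerivAt_along_line (hu.hasDerivAt_deriv _))).add
      ((hasDerivAt_one_add_pow 4 t).mul (hu.hasDerivAt_norm_sq_line 0 b t))
  have hφ : ∀ t : ℝ, HasDerivAt (fun s : ℝ => (6 + ‖lam‖) / 3 * (1 + s) ^ 3)
      ((6 + ‖lam‖) * (1 + t) ^ 2) t := by
    intro t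
    refine ((hasDerivAt_one_add_pow 3 t).const_mul ((6 + ‖lam‖) / 3)).congr_deriv ?_
    norm_num; ring
  have key := le_mul_exp_of_deriv_le hr (fun t _ => hE t) (fun t _ => hφ t) ?_
  · have : ‖u (0 + r * b)‖ ^ 2 ≤ (1 + r) ^ 4 * ‖u (0 + r * b)‖ ^ 2 :=
      le_mul_of_one_le_left (by positivity) (one_le_pow₀ (by linarith))
    have h3 := sq_nonneg ‖deriv u (0 + r * b)‖
    simp only [Complex.ofReal_zero, zero_mul, add_zero, one_pow, one_mul, mul_one] at key
    linarith
  · intro t ht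
    have ht0 := ht.1
    set z := 0 + (t : ℂ) * b with hz
    have hzn : ‖z‖ = t := by simp [hz, hb, abs_of_nonneg ht0]
    set q := Complex.I * z ^ 3 - lam with hq
    have hqn : ‖q‖ ≤ (1 + ‖lam‖) * (1 + t) ^ 4 := by
      have h1 : ‖q‖ ≤ t ^ 3 + ‖lam‖ := by
        refine (norm_sub_le _ _).trans ?_
        simp [hzn]
      have h2 : t ^ 3 ≤ (1 + t) ^ 4 :=
        (pow_le_pow_left₀ ht0 (by linarith) 3).trans (pow_le_pow_right₀ (by linarith) (by norm_num))
      have h3 : 1 ≤ (1 + t) ^ 4 := one_le_pow₀ (by linarith)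
      nlinarith [norm_nonneg lam]
    have e1 : (b * (q * u z) * conj (deriv u z)).re ≤
        (1 + ‖lam‖) * (1 + t) ^ 4 * (‖u z‖ * ‖deriv u z‖) := by
      refine (le_abs_self _).trans ((re_mul_conj_le _ _).trans ?_)
      rw [norm_mul, norm_mul, hb, one_mul, mul_assoc]
      gcongr
    have e2 : (b * deriv u z * conj (u z)).re ≤ ‖u z‖ * ‖deriv u z‖ := by
      refine (le_abs_self _).trans ((re_mul_conj_le _ _).trans ?_)
      rw [norm_mul, hb, one_mul, mul_comm]
    have e3 : 2 * (1 + t) ^ 2 * (‖u z‖ * ‖deriv u z‖) ≤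
        ‖deriv u z‖ ^ 2 + (1 + t) ^ 4 * ‖u z‖ ^ 2 := by
      nlinarith [sq_nonneg (‖deriv u z‖ - (1 + t) ^ 2 * ‖u z‖)]
    have e4 : (1 + t) ^ 3 ≤ (1 + t) ^ 2 * (1 + t) ^ 4 := by
      rw [← pow_add]; exact pow_le_pow_right₀ (by linarith) (by norm_num)
    have e5 : (1 + t) ^ 3 * ‖u z‖ ^ 2 ≤
        (1 + t) ^ 2 * (‖deriv u z‖ ^ 2 + (1 + t) ^ 4 * ‖u z‖ ^ 2) := by
      have := mul_le_mul_of_nonneg_right e4 (sq_nonneg ‖u z‖)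
      have h5 : 0 ≤ (1 + t) ^ 2 * ‖deriv u z‖ ^ 2 := by positivity
      nlinarith
    have e6 : 2 * (1 + t) ^ 4 * (‖u z‖ * ‖deriv u z‖) ≤
        (1 + t) ^ 2 * (‖deriv u z‖ ^ 2 + (1 + t) ^ 4 * ‖u z‖ ^ 2) := by
      have := mul_le_mul_of_nonneg_left e3 (sq_nonneg (1 + t))
      nlinarith
    have e7 := mul_le_mul_of_nonneg_left e6 (by positivity : 0 ≤ 1 + ‖lam‖)
    have e8 := mul_le_mul_of_nonneg_left e2 (by positivity : 0 ≤ 2 * (1 + t) ^ 4)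
    simp only [Nat.cast_ofNat, show 4 - 1 = 3 from rfl]
    nlinarith

/-- Order at most 3 is all that is used: it permits Phragmén–Lindelöf in sectors of opening below
π/3, and after a square root it becomes 3/2 < 2. -/
lemma growth (hu : IsEigenfunction lam u) :
    ∃ C B : ℝ, 0 ≤ C ∧ 0 ≤ B ∧ ∀ z, ‖u z‖ ≤ C * Real.exp (B * ‖z‖ ^ 3) := by
  set K := (6 + ‖lam‖) / 3 with hK
  have hK0 : 0 ≤ K := by positivity
  set M := ‖deriv u 0‖ ^ 2 + ‖u 0‖ ^ 2 with hM
  have hM0 : 0 ≤ M := by positivity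
  refine ⟨1 + M * Real.exp (3 * K), 4 * K, by positivity, by positivity, fun z => ?_⟩
  obtain ⟨b, hb, hzb⟩ : ∃ b : ℂ, ‖b‖ = 1 ∧ z = 0 + (‖z‖ : ℂ) * b :=
    ⟨Complex.exp (z.arg * Complex.I), Complex.norm_exp_ofReal_mul_I _, by
      rw [zero_add, Complex.norm_mul_exp_arg_mul_I]⟩
  have h := hu.norm_sq_le_exp hb (norm_nonneg z)
  rw [← hzb, ← hK, ← hM] at h
  have h1 : Real.exp (K * (1 + ‖z‖) ^ 3 - K) ≤ Real.exp (3 * K) * Real.exp (4 * K * ‖z‖ ^ 3) := by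
    rw [← Real.exp_add]
    apply Real.exp_le_exp.2
    have : (1 + ‖z‖) ^ 3 ≤ 4 + 4 * ‖z‖ ^ 3 := by
      have := norm_nonneg z
      nlinarith [mul_nonneg (by positivity : 0 ≤ ‖z‖ + 1) (sq_nonneg (‖z‖ - 1))]
    nlinarith
  have h2 : ‖u z‖ ≤ 1 + ‖u z‖ ^ 2 := by nlinarith [sq_nonneg (‖u z‖ - 1), norm_nonneg (u z)]
  have h3 : 1 ≤ Real.exp (4 * K * ‖z‖ ^ 3) := Real.one_le_exp (by positivity)
  have h4 := mul_le_mul_of_nonneg_left h1 hM0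
  nlinarith

/-- Superexponential decay on a ray inside the left-hand Stokes region. -/
lemma superexponential_decay (hu : IsEigenfunction lam u) (n : ℝ) (hn : 0 < n) :
    ∃ A S : ℝ, ∀ r : ℝ, S ≤ r →
      ‖u (r * Complex.exp (((41 * Real.pi / 40 : ℝ) : ℂ) * Complex.I))‖ ^ 2 ≤
        A * Real.exp (-(n * r ^ 2)) := by
  set θ : ℝ := 41 * Real.pi / 40 with hθ
  set b := Complex.exp ((θ : ℂ) * Complex.I) with hb
  have hbn : ‖b‖ = 1 := Complex.norm_exp_ofReal_mul_I _
  set c := Real.sin (Real.pi / 8) with hc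
  have hcpos : 0 < c := Real.sin_pos_of_pos_of_lt_pi (by positivity) (by linarith [Real.pi_pos])
  have hb5 : (Complex.I * b ^ 5).re = c := by
    rw [hb, ← Complex.exp_nat_mul]
    -- Along the ray, b² · ib³ = ib⁵, and 5 · 41π/40 = π/8 + π + 4π. Hence Re(ib⁵) = sin(π/8) > 0.
    have : ((5 : ℕ) : ℂ) * (θ * Complex.I) =
        ((Real.pi / 8 + Real.pi : ℝ) : ℂ) * Complex.I + (2 * Real.pi * Complex.I) * (2 : ℤ) := by
      rw [hθ]; push_cast; ring
    rw [this, Complex.exp_add, mul_comm (2 * (Real.pi : ℂ) * Complex.I),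
      Complex.exp_int_mul_two_pi_mul_I, mul_one, Complex.I_mul_re, Complex.exp_ofReal_mul_I_im,
      Real.sin_add_pi, neg_neg]
  have h2 := hu.hasDerivAt_re_line 0 b
  have key := gaussian_bound_of_convexity (k := c) (R := max 1 (‖lam‖ / (c / 2))) hcpos
    (hu.hasDerivAt_norm_sq_line 0 b) (fun r => (h2 r).const_mul 2)
    (fun r => sq_nonneg _) ?_ ?_ hn
  · simpa only [zero_add] using key
  · intro r hr
    have hr1 : 1 ≤ r := (le_max_left _ _).trans hr
    have hr2 : ‖lam‖ / (c / 2) ≤ r := (le_max_right _ _).trans hr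
    rw [div_le_iff₀ (by positivity)] at hr2
    have e : (b ^ 2 * (Complex.I * (0 + (r : ℂ) * b) ^ 3 - lam)).re =
        r ^ 3 * c - (b ^ 2 * lam).re := by
      have : b ^ 2 * (Complex.I * (0 + (r : ℂ) * b) ^ 3 - lam) =
          ((r ^ 3 : ℝ) : ℂ) * (Complex.I * b ^ 5) - b ^ 2 * lam := by push_cast; ring
      rw [this, Complex.sub_re, Complex.re_ofReal_mul, hb5]
    rw [e]
    have e2 : (b ^ 2 * lam).re ≤ ‖lam‖ := by
      refine (Complex.re_le_norm _).trans ?_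
      simp [hbn]
    have e3 : r ≤ r ^ 3 := by
      calc r = r ^ 1 := (pow_one r).symm
        _ ≤ r ^ 3 := pow_le_pow_right₀ hr1 (by norm_num)
    have e4 : r ^ 3 * c / 2 ≤ r ^ 3 * c - (b ^ 2 * lam).re := by nlinarith
    have e5 := mul_le_mul_of_nonneg_right e4 (sq_nonneg ‖u (0 + r * b)‖)
    have e6 : 0 ≤ ‖b‖ ^ 2 * ‖deriv u (0 + r * b)‖ ^ 2 := by positivity
    nlinarith
  · have h := hu.decay_left θ
      (by unfold criticalAngle; push_cast; rw [hθ]; linarith [Real.pi_pos])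
      (by unfold criticalAngle; push_cast; rw [hθ]; linarith [Real.pi_pos])
    simpa using h.norm.pow 2

end IsEigenfunction

/-! ### Phragmén–Lindelöf and unboundedness in the second quadrant. -/

lemma norm_exp_cube (ζ : ℂ) : ‖Complex.exp ζ‖ ^ 3 = Real.exp (3 * ζ.re) := by
  rw [Complex.norm_exp, ← Real.exp_nat_mul]; norm_num

lemma sqrt_polar {r φ : ℝ} (hr : 0 < r) (h1 : -Real.pi < φ) (h2 : φ ≤ Real.pi) :
    ((r : ℂ) ^ 2 * Complex.exp (φ * Complex.I)) ^ (2⁻¹ : ℂ) =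
      r * Complex.exp ((φ / 2 : ℝ) * Complex.I) := by
  have e : (r : ℂ) = Complex.exp (Real.log r) := by
    rw [← Complex.ofReal_exp, Real.exp_log hr]
  have e2 : (r : ℂ) ^ 2 * Complex.exp (φ * Complex.I) =
      Complex.exp (2 * Real.log r + φ * Complex.I) := by
    rw [Complex.exp_add, two_mul, Complex.exp_add, ← e, pow_two]
  rw [e2, Complex.cpow_def_of_ne_zero (Complex.exp_ne_zero _), Complex.log_exp]
  · rw [e, ← Complex.exp_add]
    congr 1
    push_cast
    ring
  · simpa using h1
  · simpa using h2

/-- Phragmén–Lindelöf in a sector of opening less than `π / 3` for entire functions of order at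
most three. -/
lemma sector_bound {u : ℂ → ℂ} (hd : Differentiable ℂ u) {A B : ℝ} (hB : 0 ≤ B) (hA : 0 ≤ A)
    (hg : ∀ z, ‖u z‖ ≤ A * Real.exp (B * ‖z‖ ^ 3)) {a b C : ℝ} (hab : a < b)
    (hba : b - a < Real.pi / 3)
    (ha : ∀ r : ℝ, 0 < r → ‖u (r * Complex.exp (a * Complex.I))‖ ≤ C)
    (hb : ∀ r : ℝ, 0 < r → ‖u (r * Complex.exp (b * Complex.I))‖ ≤ C)
    {θ r : ℝ} (h1 : a ≤ θ) (h2 : θ ≤ b) (hr : 0 < r) :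
    ‖u (r * Complex.exp (θ * Complex.I))‖ ≤ C := by
  have hpol : ∀ ζ : ℂ, Complex.exp ζ = (Real.exp ζ.re : ℂ) * Complex.exp (ζ.im * Complex.I) := by
    intro ζ
    rw [Complex.ofReal_exp, ← Complex.exp_add, Complex.re_add_im]
  -- In logarithmic coordinates the sector is a strip of width b - a and the growth is exp(B exp(3
  -- Re ζ)); admissibility is 3 < π/(b - a).
  have key := PhragmenLindelof.horizontal_strip (f := fun ζ => u (Complex.exp ζ)) (C := C)
    (a := a) (b := b) (z := Real.log r + θ * Complex.I)
    (hd.comp Complex.differentiable_exp).diffContOnCl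
    ⟨3, by rw [lt_div_iff₀ (by linarith)]; linarith, B, ?_⟩ ?_ ?_ (by simpa) (by simpa)
  · have e : (r : ℂ) * Complex.exp (θ * Complex.I) =
        Complex.exp (Real.log r + θ * Complex.I) := by
      rw [Complex.exp_add, ← Complex.ofReal_exp, Real.exp_log hr]
    rw [e]; exact key
  · apply Asymptotics.IsBigO.of_bound A
    apply Eventually.of_forall
    intro ζ
    refine (hg _).trans ?_
    rw [Real.norm_of_nonneg (Real.exp_pos _).le, norm_exp_cube]
    have : ζ.re ≤ |ζ.re| := le_abs_self _
    gcongr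
  · intro ζ hζ
    simp only [hpol ζ, hζ]
    exact ha _ (Real.exp_pos _)
  · intro ζ hζ
    simp only [hpol ζ, hζ]
    exact hb _ (Real.exp_pos _)

lemma exists_bound_of_tendsto {f : ℝ → ℂ} (hc : Continuous f) (h : Tendsto f atTop (𝓝 0)) :
    ∃ C, ∀ r : ℝ, 0 < r → ‖f r‖ ≤ C := by
  obtain ⟨T, hT⟩ := eventually_atTop.1 (h.norm.eventually_lt_const (by simp : ‖(0 : ℂ)‖ < 1))
  obtain ⟨C, hC⟩ := (isCompact_Icc (a := (0 : ℝ)) (b := T)).exists_bound_of_continuousOn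
    hc.continuousOn
  refine ⟨max C 1, fun r hr => ?_⟩
  rcases le_total r T with h | h
  · exact (hC r ⟨hr.le, h⟩).trans (le_max_left _ _)
  · exact (hT r h).le.trans (le_max_right _ _)

namespace IsEigenfunction

variable {lam : ℂ} {u : ℂ → ℂ}

lemma bounded_left (hu : IsEigenfunction lam u) {θ : ℝ} (h1 : 9 * Real.pi / 10 < θ)
    (h2 : θ < 13 * Real.pi / 10) :
    ∃ C, ∀ r : ℝ, 0 < r → ‖u (r * Complex.exp (θ * Complex.I))‖ ≤ C := by
  apply exists_bound_of_tendsto (f := fun r : ℝ => u (r * Complex.exp (θ * Complex.I)))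
  · exact hu.entire.continuous.comp (by fun_prop)
  · exact hu.decay_left θ (by unfold criticalAngle; push_cast; linarith)
      (by unfold criticalAngle; push_cast; linarith)

/-- An eigenfunction is unbounded on rays of the second quadrant away from the Stokes region
containing the negative real axis. -/
lemma unbounded_on_ray (hu : IsEigenfunction lam u) {θ C : ℝ} (h1 : 3 * Real.pi / 5 ≤ θ)
    (h2 : θ ≤ 3 * Real.pi / 4)
    (hC : ∀ r : ℝ, 0 < r → ‖u (r * Complex.exp (θ * Complex.I))‖ ≤ C) : False := by
  have hpi := Real.pi_pos
  obtain ⟨A, B, hA, hB, hg⟩ := hu.growth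
  obtain ⟨C1, hC1⟩ := hu.bounded_left (θ := 91 * Real.pi / 100) (by linarith) (by linarith)
  obtain ⟨C2, hC2⟩ := hu.bounded_left (θ := 51 * Real.pi / 40) (by linarith) (by linarith)
  -- The angles 31π/40 and 51π/40 bound a right-angled sector about 41π/40. The second edge already
  -- lies in the left Stokes region; the first is reached from θ by `sector_bound`, since 91π/100 -
  -- 3π/5 < π/3.
  have hC3 : ∀ r : ℝ, 0 < r →
      ‖u (r * Complex.exp (((31 * Real.pi / 40 : ℝ) : ℂ) * Complex.I))‖ ≤ max C C1 := fun r hr =>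
    sector_bound hu.entire hB hA hg (a := θ) (b := 91 * Real.pi / 100) (by linarith)
      (by linarith) (fun s hs => (hC s hs).trans (le_max_left _ _))
      (fun s hs => (hC1 s hs).trans (le_max_right _ _)) (by linarith) (by linarith) hr
  set b := Complex.exp (((41 * Real.pi / 40 : ℝ) : ℂ) * Complex.I) with hb
  have hb0 : b ≠ 0 := Complex.exp_ne_zero _
  have hbn : ‖b‖ = 1 := Complex.norm_exp_ofReal_mul_I _
  -- The square root maps the right half-plane onto this right-angled sector, the positive axis
  -- going to the ray of superexponential decay. Gaussian decay in r = √x becomes exponential decay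
  -- in x.
  set F : ℂ → ℂ := fun s => u (s ^ (2⁻¹ : ℂ) * b) with hF
  have hreal : ∀ r : ℝ, 0 < r → F ((r ^ 2 : ℝ) : ℂ) = u (r * b) := by
    intro r hr
    have := sqrt_polar (φ := 0) hr (by linarith) (by linarith)
    simp only [Complex.ofReal_zero, zero_mul, Complex.exp_zero, mul_one, zero_div] at this
    simp only [hF, Complex.ofReal_pow, this]
  have hcpow : ∀ s : ℂ, ‖s ^ (2⁻¹ : ℂ)‖ = ‖s‖ ^ (2⁻¹ : ℝ) := by
    intro s
    have := Complex.norm_cpow_real s (2⁻¹)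
    push_cast at this
    exact this
  have hzero := PhragmenLindelof.eq_zero_on_right_half_plane_of_superexponential_decay (f := F)
    ?_ ?_ ?_ ?_
  · obtain ⟨r, hr, hne⟩ := hu.exists_ne_zero_on_line 0 hb0 zero_lt_one
    apply hne
    rw [zero_add, ← hreal r hr.1]
    refine hzero ?_
    rw [Set.mem_ofPred_eq, Complex.ofReal_re]
    positivity
  · refine ⟨fun s hs => ?_, fun s hs => ?_⟩
    · apply DifferentiableAt.differentiableWithinAt
      apply DifferentiableAt.comp s (hu.entire _)
      apply DifferentiableAt.mul_const
      exact differentiableAt_id.cpow_const (Or.inl hs)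
    · rw [Complex.closure_setOfPred_lt_re] at hs
      apply ContinuousAt.continuousWithinAt
      apply ContinuousAt.comp (g := u) (f := fun s : ℂ => s ^ (2⁻¹ : ℂ) * b)
        hu.entire.continuous.continuousAt
      apply ContinuousAt.mul_const
      exact Complex.continuousAt_cpow_const_of_re_pos (Or.inl hs) (by norm_num)
  · refine ⟨3 / 2, by norm_num, B, ?_⟩
    apply Asymptotics.IsBigO.of_bound A
    apply Eventually.of_forall
    intro s
    refine (hg _).trans (le_of_eq ?_)
    rw [Real.norm_of_nonneg (Real.exp_pos _).le, norm_mul, hbn, mul_one, hcpow,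
      ← Real.rpow_natCast, ← Real.rpow_mul (norm_nonneg _)]
    norm_num
  · intro n
    -- The bound is on |u|², so a rate 2n + 2 leaves exp(-2x) after |u|² is multiplied by exp(nx)².
    obtain ⟨M, S, hM⟩ := hu.superexponential_decay (2 * n + 2) (by positivity)
    have hlim : Tendsto (fun x : ℝ => Real.sqrt (M * Real.exp (-(2 * x)))) atTop (𝓝 0) := by
      have h1 : Tendsto (fun x : ℝ => 2 * x) atTop atTop :=
        tendsto_id.const_mul_atTop two_pos
      have := ((Real.tendsto_exp_neg_atTop_nhds_zero.comp h1).const_mul M).sqrt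
      simpa using this
    apply squeeze_zero' _ _ hlim
    · exact Eventually.of_forall fun x => by positivity
    · filter_upwards [eventually_ge_atTop (max 1 (S ^ 2))] with x hx
      have hx0 : 0 < x := by linarith [le_max_left 1 (S ^ 2)]
      have hSx : S ≤ Real.sqrt x := Real.le_sqrt_of_sq_le ((le_max_right _ _).trans hx)
      have hs := hreal (Real.sqrt x) (Real.sqrt_pos.2 hx0)
      have hb := hM _ hSx
      rw [Real.sq_sqrt hx0.le] at hs hb
      rw [hs]
      apply Real.le_sqrt_of_sq_le
      have e : Real.exp (-(2 * x)) = Real.exp (x) ^ (2 * n) * Real.exp (-((2 * n + 2) * x)) := by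
        rw [← Real.exp_nat_mul, ← Real.exp_add]; congr 1; push_cast; ring
      rw [e, mul_pow, ← pow_mul, mul_comm n 2]
      calc _ ≤ Real.exp x ^ (2 * n) * (M * Real.exp (-((2 * n + 2) * x))) := by gcongr
        _ = _ := by ring
  · refine ⟨max (max C2 (max C C1)) ‖u 0‖, fun x => ?_⟩
    rcases lt_trichotomy x 0 with hx | hx | hx
    · have hr : 0 < Real.sqrt (-x) := Real.sqrt_pos.2 (by linarith)
      have e := sqrt_polar (φ := -(Real.pi / 2)) hr (by linarith) (by linarith)
      rw [← Complex.ofReal_pow, Real.sq_sqrt (by linarith)] at e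
      have e2 : ((-x : ℝ) : ℂ) * Complex.exp ((-(Real.pi / 2) : ℝ) * Complex.I) = x * Complex.I := by
        have : ((-(Real.pi / 2) : ℝ) : ℂ) * Complex.I = -Real.pi / 2 * Complex.I := by push_cast; ring
        rw [this, Complex.exp_neg_pi_div_two_mul_I]
        push_cast; ring
      rw [e2] at e
      simp only [hF, e]
      refine le_trans ?_ (le_trans (le_max_right C2 _) (le_max_left _ _))
      have e3 : ((-(Real.pi / 2) / 2 : ℝ) : ℂ) * Complex.I + ((41 * Real.pi / 40 : ℝ) : ℂ) * Complex.I =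
          ((31 * Real.pi / 40 : ℝ) : ℂ) * Complex.I := by push_cast; ring
      rw [mul_assoc, hb, ← Complex.exp_add, e3]
      exact hC3 _ hr
    · simp [hx, hF]
    · have hr : 0 < Real.sqrt x := Real.sqrt_pos.2 (by linarith)
      have e := sqrt_polar (φ := Real.pi / 2) hr (by linarith) (by linarith)
      rw [← Complex.ofReal_pow, Real.sq_sqrt (by linarith)] at e
      have e2 : (x : ℂ) * Complex.exp ((Real.pi / 2 : ℝ) * Complex.I) = x * Complex.I := by
        push_cast
        rw [Complex.exp_pi_div_two_mul_I]
      rw [e2] at e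
      simp only [hF, e]
      refine le_trans ?_ (le_trans (le_max_left C2 _) (le_max_left _ _))
      have e3 : ((Real.pi / 2 / 2 : ℝ) : ℂ) * Complex.I + ((41 * Real.pi / 40 : ℝ) : ℂ) * Complex.I =
          ((51 * Real.pi / 40 : ℝ) : ℂ) * Complex.I := by push_cast; ring
      rw [mul_assoc, hb, ← Complex.exp_add, e3]
      exact hC2 _ hr

end IsEigenfunction

/-! ### Zeros of small perturbations of f'' = f. -/

/-- Comparison of `f'' = (1 + e) f` with `g'' = g` on a disc. -/
lemma norm_sub_exp_comb_le {f f₁ e : ℂ → ℂ} {ε : ℝ} (hε : ε ≤ 1)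
    (hf : ∀ ζ, HasDerivAt f (f₁ ζ) ζ) (hf₁ : ∀ ζ, HasDerivAt f₁ ((1 + e ζ) * f ζ) ζ)
    (he : ∀ ζ, ‖ζ‖ ≤ 5 → ‖e ζ‖ ≤ ε) {ζ : ℂ} (hζ : ‖ζ‖ ≤ 5) :
    ‖f ζ - ((f 0 + f₁ 0) / 2 * Complex.exp ζ + (f 0 - f₁ 0) / 2 * Complex.exp (-ζ))‖ ≤
      ε * Real.exp 15 * max ‖f 0‖ ‖f₁ 0‖ := by
  set g : ℂ → ℂ := fun ζ =>
    (f 0 + f₁ 0) / 2 * Complex.exp ζ + (f 0 - f₁ 0) / 2 * Complex.exp (-ζ) with hg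
  set g₁ : ℂ → ℂ := fun ζ =>
    (f 0 + f₁ 0) / 2 * Complex.exp ζ - (f 0 - f₁ 0) / 2 * Complex.exp (-ζ) with hg₁
  have hexpneg : ∀ ζ, HasDerivAt (fun ζ => Complex.exp (-ζ)) (-Complex.exp (-ζ)) ζ := by
    intro ζ
    simpa using ((hasDerivAt_neg ζ).cexp)
  have hgd : ∀ ζ, HasDerivAt g (g₁ ζ) ζ := fun ζ =>
    (((Complex.hasDerivAt_exp ζ).const_mul _).add ((hexpneg ζ).const_mul _)).congr_deriv
      (by simp only [hg₁]; ring)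
  have hg₁d : ∀ ζ, HasDerivAt g₁ (g ζ) ζ := fun ζ =>
    (((Complex.hasDerivAt_exp ζ).const_mul _).sub ((hexpneg ζ).const_mul _)).congr_deriv
      (by simp only [hg]; ring)
  set M := max ‖f 0‖ ‖f₁ 0‖ with hM
  have hε0 : 0 ≤ ε := (norm_nonneg _).trans (he 0 (by simp))
  set X : ℝ → ℂ × ℂ := fun t => (f (0 + t * ζ), f₁ (0 + t * ζ)) with hX
  have hXd : ∀ t : ℝ, HasDerivAt X (ζ * f₁ (0 + t * ζ), ζ * ((1 + e (0 + t * ζ)) * f (0 + t * ζ)))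
      t := fun t => (hasDerivAt_along_line (hf _)).prodMk (hasDerivAt_along_line (hf₁ _))
  have hball : ∀ t ∈ Set.Ico (0 : ℝ) 1, ‖0 + (t : ℂ) * ζ‖ ≤ 5 := by
    intro t ht
    rw [zero_add, norm_mul, Complex.norm_real, Real.norm_of_nonneg ht.1]
    nlinarith [norm_nonneg ζ, ht.1, ht.2]
  -- A priori Grönwall bound for (f, f₁) with rate 10 = 5 · 2, from |ζ| ≤ 5 and |1 + e| ≤ 2. It
  -- serves to control the forcing term ef in the equation for the difference.
  have hXb : ∀ t ∈ Set.Icc (0 : ℝ) 1, ‖X t‖ ≤ M * Real.exp (10 * t) := by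
    have key := norm_le_gronwallBound_of_norm_deriv_right_le (f := X) (δ := M) (K := 10) (ε := 0)
      (a := 0) (b := 1) (fun t _ => (hXd t).continuousAt.continuousWithinAt)
      (fun t _ => (hXd t).hasDerivWithinAt) (by simp [hX, hM, Prod.norm_def]) ?_
    · intro t ht
      simpa [gronwallBound_ε0] using key t ht
    · intro t ht
      have h1 : ‖f (0 + t * ζ)‖ ≤ ‖X t‖ := norm_fst_le (X t)
      have h2 : ‖f₁ (0 + t * ζ)‖ ≤ ‖X t‖ := norm_snd_le (X t)
      have h3 := he _ (hball t ht)
      have h4 : ‖1 + e (0 + t * ζ)‖ ≤ 2 := by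
        refine (norm_add_le _ _).trans ?_
        rw [norm_one]; linarith
      rw [add_zero, Prod.norm_def]
      apply max_le
      · rw [norm_mul]
        nlinarith [norm_nonneg ζ, norm_nonneg (f₁ (0 + t * ζ)), norm_nonneg (X t)]
      · rw [norm_mul, norm_mul]
        calc ‖ζ‖ * (‖1 + e (0 + t * ζ)‖ * ‖f (0 + t * ζ)‖) ≤ 5 * (2 * ‖X t‖) := by gcongr
          _ = 10 * ‖X t‖ := by ring
  set D : ℝ → ℂ × ℂ := fun t => (f (0 + t * ζ) - g (0 + t * ζ), f₁ (0 + t * ζ) - g₁ (0 + t * ζ))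
    with hD
  have hDd : ∀ t : ℝ, HasDerivAt D (ζ * (f₁ (0 + t * ζ) - g₁ (0 + t * ζ)),
      ζ * ((1 + e (0 + t * ζ)) * f (0 + t * ζ) - g (0 + t * ζ))) t := fun t =>
    (hasDerivAt_along_line (F := fun ζ => f ζ - g ζ) ((hf _).sub (hgd _))).prodMk
      (hasDerivAt_along_line (F := fun ζ => f₁ ζ - g₁ ζ) ((hf₁ _).sub (hg₁d _)))
  have hM0 : 0 ≤ M := (norm_nonneg (f 0)).trans (le_max_left _ _)
  have key := norm_le_gronwallBound_of_norm_deriv_right_le (f := D) (δ := 0) (K := 5)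
    (ε := 5 * (ε * (M * Real.exp 10)))
    (a := 0) (b := 1) (fun t _ => (hDd t).continuousAt.continuousWithinAt)
    (fun t _ => (hDd t).hasDerivWithinAt) ?_ ?_ 1 (by simp)
  · have h1 : ‖f ζ - g ζ‖ ≤ ‖D 1‖ := by
      simpa only [hD, Complex.ofReal_one, one_mul, zero_add] using norm_fst_le (D 1)
    refine h1.trans (key.trans ?_)
    rw [gronwallBound_of_K_ne_0 (by norm_num)]
    simp only [zero_mul, zero_add, sub_zero, mul_one]
    have : Real.exp 15 = Real.exp 10 * Real.exp 5 := by rw [← Real.exp_add]; norm_num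
    rw [this]
    have : 0 ≤ ε * (M * Real.exp 10) := by positivity
    have h5 := Real.exp_pos 5
    calc _ = ε * (M * Real.exp 10) * (Real.exp 5 - 1) := by ring
      _ ≤ ε * (M * Real.exp 10) * Real.exp 5 := by gcongr; linarith
      _ = _ := by ring
  · have e1 : f 0 - g 0 = 0 := by simp only [hg, neg_zero, Complex.exp_zero]; ring
    have e2 : f₁ 0 - g₁ 0 = 0 := by simp only [hg₁, neg_zero, Complex.exp_zero]; ring
    simp [hD, e1, e2]
  · intro t ht
    have h1 : ‖f (0 + t * ζ) - g (0 + t * ζ)‖ ≤ ‖D t‖ := norm_fst_le (D t)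
    have h2 : ‖f₁ (0 + t * ζ) - g₁ (0 + t * ζ)‖ ≤ ‖D t‖ := norm_snd_le (D t)
    have h3 := he _ (hball t ht)
    have h4 : ‖f (0 + t * ζ)‖ ≤ M * Real.exp 10 := by
      refine (norm_fst_le (X t)).trans ((hXb t ⟨ht.1, ht.2.le⟩).trans ?_)
      have := ht.2
      gcongr
      linarith
    have h5 : 0 ≤ ε * (M * Real.exp 10) := by positivity
    rw [Prod.norm_def]
    apply max_le
    · rw [norm_mul]
      nlinarith [norm_nonneg ζ, norm_nonneg (D t), norm_nonneg (f₁ (0 + t * ζ) - g₁ (0 + t * ζ))]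
    · have h6 : (1 + e (0 + t * ζ)) * f (0 + t * ζ) - g (0 + t * ζ) =
          (f (0 + t * ζ) - g (0 + t * ζ)) + e (0 + t * ζ) * f (0 + t * ζ) := by ring
      rw [norm_mul, h6]
      have h7 : ‖(f (0 + t * ζ) - g (0 + t * ζ)) + e (0 + t * ζ) * f (0 + t * ζ)‖ ≤
          ‖D t‖ + ε * (M * Real.exp 10) := by
        refine (norm_add_le _ _).trans (add_le_add h1 ?_)
        rw [norm_mul]
        gcongr
      calc _ ≤ 5 * (‖D t‖ + ε * (M * Real.exp 10)) := by gcongr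
        _ = _ := by ring

/-- If the solution of `f'' = (1 + e) f` is close to a balanced combination of `exp ζ` and
`exp (-ζ)`, it has a zero in the disc. -/
lemma exists_zero_of_balanced {f f₁ e : ℂ → ℂ} {ε : ℝ} (hε : ε ≤ Real.exp (-15) / 100)
    (hf : ∀ ζ, HasDerivAt f (f₁ ζ) ζ) (hf₁ : ∀ ζ, HasDerivAt f₁ ((1 + e ζ) * f ζ) ζ)
    (he : ∀ ζ, ‖ζ‖ ≤ 5 → ‖e ζ‖ ≤ ε) (h0 : f 0 ≠ 0)
    (hab : ‖f 0 + f₁ 0‖ ≤ 5 * ‖f 0 - f₁ 0‖) (hba : ‖f 0 - f₁ 0‖ ≤ 5 * ‖f 0 + f₁ 0‖) :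
    ∃ ζ, ‖ζ‖ ≤ 5 ∧ f ζ = 0 := by
  by_contra! hne
  set A := (f 0 + f₁ 0) / 2 with hA
  set B := (f 0 - f₁ 0) / 2 with hB
  have hAB : ‖A‖ ≤ 5 * ‖B‖ := by rw [hA, hB, norm_div, norm_div, Complex.norm_ofNat]; linarith
  have hBA : ‖B‖ ≤ 5 * ‖A‖ := by rw [hA, hB, norm_div, norm_div, Complex.norm_ofNat]; linarith
  have hsum : f 0 = A + B := by rw [hA, hB]; ring
  have hdiff : f₁ 0 = A - B := by rw [hA, hB]; ring
  have hA0 : A ≠ 0 := by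
    intro h
    have : ‖B‖ ≤ 0 := by simpa [h] using hBA
    exact h0 (by rw [hsum, h, norm_le_zero_iff.1 this, add_zero])
  have hB0 : B ≠ 0 := by
    intro h
    have : ‖A‖ ≤ 0 := by simpa [h] using hAB
    exact hA0 (norm_le_zero_iff.1 this)
  have hAp : 0 < ‖A‖ := norm_pos_iff.2 hA0
  have hBp : 0 < ‖B‖ := norm_pos_iff.2 hB0
  -- A zero of A exp ζ + B exp(-ζ), i.e. exp(2ζ₀) = -B/A. Balance bounds the real part of the
  -- logarithm by 4 and its imaginary part by 3.2, so |ζ₀| ≤ 18/5 and the disc of radius 1/2 about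
  -- ζ₀ stays inside |ζ| ≤ 5.
  set ζ₀ := Complex.log (-B / A) / 2 with hζ₀
  have hq0 : -B / A ≠ 0 := div_ne_zero (neg_ne_zero.2 hB0) hA0
  have hexp2 : Complex.exp ζ₀ * Complex.exp ζ₀ = -B / A := by
    rw [← Complex.exp_add, hζ₀, add_halves, Complex.exp_log hq0]
  have hroot : B * Complex.exp (-ζ₀) = -(A * Complex.exp ζ₀) := by
    have h1 : Complex.exp ζ₀ * Complex.exp (-ζ₀) = 1 := by rw [← Complex.exp_add]; simp
    have h2 : A * (Complex.exp ζ₀ * Complex.exp ζ₀) = -B := by rw [hexp2]; field_simp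
    linear_combination Complex.exp (-ζ₀) * h2 - (A * Complex.exp ζ₀) * h1
  have hζ₀n : ‖ζ₀‖ ≤ 18 / 5 := by
    have h1 : ‖Complex.log (-B / A)‖ ≤ |(Complex.log (-B / A)).re| + |(Complex.log (-B / A)).im| :=
      Complex.norm_le_abs_re_add_abs_im _
    have h2 : |(Complex.log (-B / A)).im| ≤ 3.2 := by
      rw [Complex.log_im]
      exact (Complex.abs_arg_le_pi _).trans (by linarith [Real.pi_lt_d2])
    have h3 : |(Complex.log (-B / A)).re| ≤ 4 := by
      rw [Complex.log_re, norm_div, norm_neg, abs_le, Real.log_div hBp.ne' hAp.ne']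
      have l5 : Real.log 5 ≤ 4 := by
        have := Real.log_le_sub_one_of_pos (by norm_num : (0 : ℝ) < 5)
        linarith
      have l1 := Real.log_le_log hAp hAB
      have l2 := Real.log_le_log hBp hBA
      rw [Real.log_mul (by norm_num) hBp.ne'] at l1
      rw [Real.log_mul (by norm_num) hAp.ne'] at l2
      constructor <;> linarith
    rw [hζ₀, norm_div, Complex.norm_ofNat]
    linarith
  have hAe : ‖A‖ / 3 ≤ ‖A * Complex.exp ζ₀‖ := by
    have h1 : ‖A * Complex.exp ζ₀‖ ^ 2 = ‖A‖ * ‖B‖ := by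
      rw [← norm_pow]
      have : (A * Complex.exp ζ₀) ^ 2 = -(A * B) := by
        have h2 : A * (Complex.exp ζ₀ * Complex.exp ζ₀) = -B := by rw [hexp2]; field_simp
        linear_combination A * h2
      rw [this, norm_neg, norm_mul]
    apply le_of_sq_le_sq _ (norm_nonneg _)
    rw [h1]
    nlinarith
  have hM : max ‖f 0‖ ‖f₁ 0‖ ≤ 6 * ‖A‖ := by
    rw [hsum, hdiff]
    apply max_le
    · linarith [norm_add_le A B]
    · linarith [norm_sub_le A B]
  have hmul : Real.exp (-15) * Real.exp 15 = 1 := by rw [← Real.exp_add]; simp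
  have hε1 : ε ≤ 1 := by
    have : Real.exp (-15) ≤ 1 := Real.exp_le_one_iff.2 (by norm_num)
    linarith
  have hε0 : 0 ≤ ε := (norm_nonneg _).trans (he 0 (by simp))
  -- The choice of ε cancels the factor exp 15, and the initial data are at most 6‖A‖.
  set η := ‖A‖ * (6 / 100) with hη
  have happrox : ∀ ζ, ‖ζ‖ ≤ 5 → ‖f ζ - (A * Complex.exp ζ + B * Complex.exp (-ζ))‖ ≤ η := by
    intro ζ hζ
    refine (norm_sub_exp_comb_le hε1 hf hf₁ he hζ).trans ?_
    calc ε * Real.exp 15 * max ‖f 0‖ ‖f₁ 0‖ ≤ (Real.exp (-15) / 100) * Real.exp 15 * (6 * ‖A‖) := by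
          gcongr
      _ = (Real.exp (-15) * Real.exp 15) * (‖A‖ * (6 / 100)) := by ring
      _ = η := by rw [hmul, one_mul]
  have hballs : ∀ ζ ∈ Metric.closedBall ζ₀ (1 / 2), ‖ζ‖ ≤ 5 := by
    intro ζ hζ
    rw [mem_closedBall_iff_norm] at hζ
    have := norm_le_norm_add_norm_sub' ζ ζ₀
    linarith
  have hcirc : ∀ ζ ∈ Metric.sphere ζ₀ (1 / 2), ‖A‖ * (10 / 100) ≤ ‖f ζ‖ := by
    intro ζ hζ
    have h5 := happrox ζ (hballs ζ (Metric.sphere_subset_closedBall hζ))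
    rw [mem_sphere_iff_norm] at hζ
    set τ := ζ - ζ₀ with hτ
    have e1 : A * Complex.exp ζ + B * Complex.exp (-ζ) =
        A * Complex.exp ζ₀ * (Complex.exp τ - Complex.exp (-τ)) := by
      have : ζ = ζ₀ + τ := by rw [hτ]; ring
      rw [this, neg_add, Complex.exp_add, Complex.exp_add]
      linear_combination Complex.exp (-τ) * hroot
    have e2 : 1 / 2 ≤ ‖Complex.exp τ - Complex.exp (-τ)‖ := by
      have b1 := Complex.norm_exp_sub_one_sub_id_le (x := τ) (by rw [hζ]; norm_num)
      have b2 := Complex.norm_exp_sub_one_sub_id_le (x := -τ) (by rw [norm_neg, hζ]; norm_num)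
      rw [norm_neg] at b2
      have b3 : (2 : ℂ) * τ = (Complex.exp τ - Complex.exp (-τ)) -
          ((Complex.exp τ - 1 - τ) - (Complex.exp (-τ) - 1 - -τ)) := by ring
      have b4 : ‖(2 : ℂ) * τ‖ = 1 := by rw [norm_mul, hζ, Complex.norm_ofNat]; norm_num
      have b5 := norm_sub_le (Complex.exp τ - Complex.exp (-τ))
        ((Complex.exp τ - 1 - τ) - (Complex.exp (-τ) - 1 - -τ))
      have b6 := norm_sub_le (Complex.exp τ - 1 - τ) (Complex.exp (-τ) - 1 - -τ)
      rw [← b3, b4] at b5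
      rw [hζ] at b1 b2
      linarith
    have e3 : ‖A‖ / 6 ≤ ‖A * Complex.exp ζ + B * Complex.exp (-ζ)‖ := by
      rw [e1, norm_mul]
      calc ‖A‖ / 6 = ‖A‖ / 3 * (1 / 2) := by ring
        _ ≤ _ := by gcongr
    have e4 := norm_sub_norm_le (A * Complex.exp ζ + B * Complex.exp (-ζ)) (f ζ)
    rw [norm_sub_rev] at e4
    rw [hη] at h5
    linarith
  have hdf : Differentiable ℂ f := fun ζ => (hf ζ).differentiableAt
  -- Were f zero-free, the maximum principle for 1/f would give |f ζ₀| ≥ ‖A‖/10 from the circle,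
  -- against |f ζ₀| ≤ η = 6‖A‖/100 at the centre.
  have hinv : ‖(f ζ₀)⁻¹‖ ≤ (‖A‖ * (10 / 100))⁻¹ := by
    apply Complex.norm_le_of_forall_mem_frontier_norm_le (f := fun ζ => (f ζ)⁻¹)
      (U := Metric.ball ζ₀ (1 / 2)) Metric.isBounded_ball
    · apply DiffContOnCl.inv hdf.diffContOnCl
      intro ζ hζ
      exact hne ζ (hballs ζ (Metric.closure_ball_subset_closedBall hζ))
    · intro ζ hζ
      rw [frontier_ball ζ₀ (by norm_num)] at hζ
      rw [norm_inv]
      exact inv_anti₀ (by positivity) (hcirc ζ hζ)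
    · exact subset_closure (Metric.mem_ball_self (by norm_num))
  have hcen : ‖f ζ₀‖ ≤ η := by
    have := happrox ζ₀ (by linarith)
    rwa [hroot, add_neg_cancel, sub_zero] at this
  have hfp : 0 < ‖f ζ₀‖ := norm_pos_iff.2 (hne ζ₀ (by linarith))
  rw [norm_inv, inv_le_inv₀ hfp (by positivity)] at hinv
  rw [hη] at hcen
  linarith

/-! ### The coordinate z = iw² and the cone where w⁶ dominates. -/

/-- The slope 1/4 keeps 6|arg w| below π/2, as 6 arctan(1/4) is about 84 degrees. -/
lemma re_pow_six_ge {w : ℂ} (h : |w.im| ≤ w.re / 4) :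
    w.re ^ 6 / 16 ≤ (w ^ 6).re := by
  have e : (w ^ 6).re = w.re ^ 6 - 15 * w.re ^ 4 * w.im ^ 2 + 15 * w.re ^ 2 * w.im ^ 4 -
      w.im ^ 6 := by
    simp only [pow_succ, pow_zero, one_mul, Complex.mul_re, Complex.mul_im]
    ring
  have hs : w.im ^ 2 ≤ w.re ^ 2 / 16 := by
    have := pow_le_pow_left₀ (abs_nonneg _) h 2
    rw [sq_abs] at this
    linarith
  rw [e]
  set X := w.re ^ 2
  set Y := w.im ^ 2
  have hX : 0 ≤ X := sq_nonneg _
  have hY : 0 ≤ Y := sq_nonneg _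
  have e1 : w.re ^ 6 = X ^ 3 := by simp only [X]; ring
  have e2 : w.re ^ 4 = X ^ 2 := by simp only [X]; ring
  have e3 : w.im ^ 6 = Y ^ 3 := by simp only [Y]; ring
  have e4 : w.im ^ 4 = Y ^ 2 := by simp only [Y]; ring
  rw [e1, e2, e3, e4]
  have k1 : 15 * X ^ 2 * Y ≤ 15 * X ^ 2 * (X / 16) := by gcongr
  have k2 : Y ^ 3 ≤ 15 * X * Y ^ 2 := by nlinarith [sq_nonneg Y]
  nlinarith

/-- The points at which the eigenfunction is rescaled. -/
def cone (R : ℝ) : Set ℂ := {w | |w.im| ≤ w.re / 4 ∧ R ≤ w.re}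

lemma cone_convex (R : ℝ) : Convex ℝ (cone R) := by
  intro w hw v hv a b ha hb hab
  obtain ⟨h1, h2⟩ := hw
  obtain ⟨h3, h4⟩ := hv
  rw [abs_le] at h1 h3
  refine ⟨?_, ?_⟩
  · simp only [Complex.add_re, Complex.add_im, Complex.real_smul, Complex.re_ofReal_mul,
      Complex.im_ofReal_mul, abs_le]
    constructor <;> nlinarith
  · simp only [Complex.add_re, Complex.real_smul, Complex.re_ofReal_mul]
    nlinarith

/-- The relative error of the potential after rescaling at `I w²`. -/
def potentialError (lam w ζ : ℂ) : ℂ :=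
  (Complex.I * (Complex.I * w ^ 2 + ζ / w ^ 3) ^ 3 - lam) / w ^ 6 - 1

/-- Since i(iw²)³ = w⁶, the leading term cancels against 1. The remaining bound is crude but tends
to zero uniformly on the disc |ζ| ≤ 5. -/
lemma norm_potentialError_le {lam w ζ : ℂ} (hw : 5 ≤ ‖w‖) (hζ : ‖ζ‖ ≤ 5) :
    ‖potentialError lam w ζ‖ ≤ (35 + ‖lam‖) / ‖w‖ := by
  have hw0 : w ≠ 0 := by rintro rfl; simp at hw; linarith
  set h := ζ / w ^ 3 with hh
  set ρ := ‖w‖ with hρ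
  have hρ1 : 1 ≤ ρ := by linarith
  have hn : ‖h‖ ≤ 1 / ρ ^ 2 := by
    rw [hh, norm_div, norm_pow, ← hρ, div_le_div_iff₀ (by positivity) (by positivity)]
    nlinarith [sq_nonneg ρ]
  have hn1 : ‖h‖ ≤ 1 := hn.trans (by rw [div_le_one (by positivity)]; exact one_le_pow₀ hρ1)
  have e : potentialError lam w ζ =
      (Complex.I * (h * (-3 * w ^ 4 + 3 * Complex.I * w ^ 2 * h + h ^ 2)) - lam) / w ^ 6 := by
    rw [potentialError, ← hh, eq_div_iff (pow_ne_zero 6 hw0), sub_mul, div_mul_cancel₀ _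
      (pow_ne_zero 6 hw0)]
    have h2 := Complex.I_sq
    linear_combination (w ^ 6 * (Complex.I ^ 2 - 1) + 3 * h * w ^ 4 * Complex.I ) * h2
  have hpoly : ‖-3 * w ^ 4 + 3 * Complex.I * w ^ 2 * h + h ^ 2‖ ≤ 7 * ρ ^ 4 := by
    refine (norm_add_le _ _).trans ?_
    have t1 : ‖-3 * w ^ 4 + 3 * Complex.I * w ^ 2 * h‖ ≤ 3 * ρ ^ 4 + 3 * ρ ^ 2 * ‖h‖ := by
      refine (norm_add_le _ _).trans ?_
      simp [hρ]
    have t2 : ‖h ^ 2‖ ≤ 1 := by rw [norm_pow]; exact pow_le_one₀ (norm_nonneg _) hn1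
    have t3 : ρ ^ 2 ≤ ρ ^ 4 := pow_le_pow_right₀ hρ1 (by norm_num)
    have t4 : 1 ≤ ρ ^ 4 := one_le_pow₀ hρ1
    nlinarith [sq_nonneg ρ]
  have hnum : ‖Complex.I * (h * (-3 * w ^ 4 + 3 * Complex.I * w ^ 2 * h + h ^ 2)) - lam‖ ≤
      (35 + ‖lam‖) * ρ ^ 5 := by
    refine (norm_sub_le _ _).trans ?_
    rw [norm_mul, norm_mul, Complex.norm_I, one_mul]
    have t1 : ‖h‖ * ‖-3 * w ^ 4 + 3 * Complex.I * w ^ 2 * h + h ^ 2‖ ≤ 1 * (7 * ρ ^ 4) := by gcongr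
    have t3 : ρ ^ 4 ≤ ρ ^ 5 := pow_le_pow_right₀ hρ1 (by norm_num)
    have t4 : 1 ≤ ρ ^ 5 := one_le_pow₀ hρ1
    nlinarith [norm_nonneg lam]
  rw [e, norm_div, norm_pow, ← hρ, div_le_div_iff₀ (by positivity) (by positivity)]
  calc _ ≤ (35 + ‖lam‖) * ρ ^ 5 * ρ := by gcongr
    _ = _ := by ring

/-- The whole rescaled disc stays in A₁ and far from the origin, so a zero found there contradicts
the absence of distant zeros in A₁. -/
lemma rescaled_mem_regionA₁ {lam w ζ : ℂ} (h1 : |w.im| ≤ w.re / 4) (h2 : 5 ≤ w.re)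
    (hζ : ‖ζ‖ ≤ 5) (he : ‖potentialError lam w ζ‖ ≤ 1 / 100) :
    Complex.I * w ^ 2 + ζ / w ^ 3 ∈ regionA₁ lam ∧
      ‖w‖ ≤ ‖Complex.I * w ^ 2 + ζ / w ^ 3‖ := by
  have hwn : 5 ≤ ‖w‖ := h2.trans (Complex.re_le_norm w)
  have hw0 : w ≠ 0 := by rintro rfl; simp at hwn; linarith
  have hn : ‖ζ / w ^ 3‖ ≤ 1 := by
    rw [norm_div, norm_pow, div_le_one (by positivity)]
    calc ‖ζ‖ ≤ ‖w‖ ^ 1 := by linarith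
      _ ≤ ‖w‖ ^ 3 := pow_le_pow_right₀ (by linarith) (by norm_num)
  have hs : w.im ^ 2 ≤ w.re ^ 2 / 16 := by
    have := pow_le_pow_left₀ (abs_nonneg _) h1 2
    rw [sq_abs] at this
    linarith
  refine ⟨⟨?_, ?_⟩, ?_⟩
  · have := (abs_le.1 ((Complex.abs_im_le_norm (ζ / w ^ 3)).trans hn)).1
    have e : (w ^ 2).re = w.re ^ 2 - w.im ^ 2 := by
      rw [pow_two, Complex.mul_re]; ring
    rw [Complex.add_im, Complex.I_mul_im, e]
    nlinarith
  · have e : Complex.I * (Complex.I * w ^ 2 + ζ / w ^ 3) ^ 3 - lam =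
        w ^ 6 + w ^ 6 * potentialError lam w ζ := by
      rw [potentialError]
      field_simp
      ring
    have h6 := re_pow_six_ge h1
    have hn2 : ‖w‖ ^ 2 = w.re ^ 2 + w.im ^ 2 := by
      rw [← Complex.normSq_eq_norm_sq, Complex.normSq_apply]; ring
    have hn6 : ‖w‖ ^ 6 ≤ 5 * w.re ^ 6 := by
      have : ‖w‖ ^ 2 ≤ 17 / 16 * w.re ^ 2 := by rw [hn2]; linarith
      calc ‖w‖ ^ 6 = (‖w‖ ^ 2) ^ 3 := by ring
        _ ≤ (17 / 16 * w.re ^ 2) ^ 3 := by gcongr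
        _ = (17 / 16) ^ 3 * w.re ^ 6 := by ring
        _ ≤ _ := by gcongr; norm_num
    have h7 : ‖w ^ 6 * potentialError lam w ζ‖ ≤ w.re ^ 6 / 20 := by
      rw [norm_mul, norm_pow]
      calc ‖w‖ ^ 6 * ‖potentialError lam w ζ‖ ≤ 5 * w.re ^ 6 * (1 / 100) := by gcongr
        _ = _ := by ring
    have h8 := (abs_le.1 ((Complex.abs_re_le_norm _).trans h7)).1
    have h9 : 0 < w.re ^ 6 := by positivity
    rw [e, Complex.add_re]
    linarith
  · have e := norm_sub_norm_le (Complex.I * w ^ 2) (-(ζ / w ^ 3))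
    rw [sub_neg_eq_add, norm_neg, norm_mul, Complex.norm_I, one_mul, norm_pow] at e
    nlinarith

/-! ### Zero-free behaviour far out in A₁. -/

namespace IsEigenfunction

variable {lam : ℂ} {u : ℂ → ℂ}

/-- If `u` has no zeros far out in `A₁`, then far out it is locally close to a pure exponential. -/
lemma dichotomy (hu : IsEigenfunction lam u) {N : ℝ}
    (hN : ∀ z ∈ regionA₁ lam, N ≤ ‖z‖ → u z ≠ 0) :
    ∃ R, 5 ≤ R ∧ ∀ w ∈ cone R, u (Complex.I * w ^ 2) ≠ 0 ∧
      (5 * ‖1 + deriv u (Complex.I * w ^ 2) / (w ^ 3 * u (Complex.I * w ^ 2))‖ <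
        ‖1 - deriv u (Complex.I * w ^ 2) / (w ^ 3 * u (Complex.I * w ^ 2))‖ ∨
      5 * ‖1 - deriv u (Complex.I * w ^ 2) / (w ^ 3 * u (Complex.I * w ^ 2))‖ <
        ‖1 + deriv u (Complex.I * w ^ 2) / (w ^ 3 * u (Complex.I * w ^ 2))‖) := by
  set ε := Real.exp (-15) / 100 with hε
  have hε0 : 0 < ε := by positivity
  have hε1 : ε ≤ 1 / 100 := by
    have : Real.exp (-15) ≤ 1 := Real.exp_le_one_iff.2 (by norm_num)
    linarith
  refine ⟨max 5 (max N ((35 + ‖lam‖) / ε)), le_max_left _ _, fun w hw => ?_⟩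
  obtain ⟨hw1, hw2⟩ := hw
  have hw5 : 5 ≤ w.re := (le_max_left _ _).trans hw2
  have hwN : N ≤ w.re := ((le_max_left _ _).trans (le_max_right _ _)).trans hw2
  have hwε : (35 + ‖lam‖) / ε ≤ w.re := ((le_max_right _ _).trans (le_max_right _ _)).trans hw2
  have hwn : w.re ≤ ‖w‖ := Complex.re_le_norm w
  have hw0 : w ≠ 0 := by rintro rfl; simp at hw5; linarith
  have he : ∀ ζ, ‖ζ‖ ≤ 5 → ‖potentialError lam w ζ‖ ≤ ε := by
    intro ζ hζ
    refine (norm_potentialError_le (hw5.trans hwn) hζ).trans ?_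
    rw [div_le_iff₀ (by linarith)]
    rw [div_le_iff₀ hε0] at hwε
    nlinarith
  have hne : ∀ ζ, ‖ζ‖ ≤ 5 → u (Complex.I * w ^ 2 + ζ / w ^ 3) ≠ 0 := by
    intro ζ hζ
    obtain ⟨h1, h2⟩ := rescaled_mem_regionA₁ hw1 hw5 hζ ((he ζ hζ).trans hε1)
    exact hN _ h1 (by linarith)
  have h0 : u (Complex.I * w ^ 2) ≠ 0 := by simpa using hne 0 (by simp)
  refine ⟨h0, ?_⟩
  by_contra! hbal
  -- In the variable ζ the logarithmic derivative at the centre is p, so the coefficients of exp ζ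
  -- and exp(-ζ) are proportional to 1 + p and 1 - p.
  set p := deriv u (Complex.I * w ^ 2) / (w ^ 3 * u (Complex.I * w ^ 2)) with hp
  have hin : ∀ ζ : ℂ, HasDerivAt (fun ζ => Complex.I * w ^ 2 + ζ / w ^ 3) (1 / w ^ 3) ζ :=
    fun ζ => ((hasDerivAt_id ζ).div_const _).const_add _
  have hpu : deriv u (Complex.I * w ^ 2) / w ^ 3 = p * u (Complex.I * w ^ 2) := by
    rw [hp]; field_simp
  have key := exists_zero_of_balanced (e := potentialError lam w)
    (f := fun ζ => u (Complex.I * w ^ 2 + ζ / w ^ 3))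
    (f₁ := fun ζ => deriv u (Complex.I * w ^ 2 + ζ / w ^ 3) / w ^ 3) (le_refl ε) ?_ ?_ he
    (hne 0 (by simp)) ?_ ?_
  · obtain ⟨ζ, hζ, hz⟩ := key
    exact hne ζ hζ hz
  · intro ζ
    exact (HasDerivAt.comp ζ (hu.hasDerivAt _) (hin ζ)).congr_deriv (by ring)
  · intro ζ
    refine ((HasDerivAt.comp ζ (hu.hasDerivAt_deriv _) (hin ζ)).div_const (w ^ 3)).congr_deriv ?_
    rw [potentialError]
    field_simp
    ring
  · simp only [zero_div, add_zero, hpu]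
    rw [show ∀ x : ℂ, x + p * x = (1 + p) * x by intro x; ring,
      show ∀ x : ℂ, x - p * x = (1 - p) * x by intro x; ring, norm_mul, norm_mul, ← mul_assoc]
    exact mul_le_mul_of_nonneg_right hbal.2 (norm_nonneg _)
  · simp only [zero_div, add_zero, hpu]
    rw [show ∀ x : ℂ, x + p * x = (1 + p) * x by intro x; ring,
      show ∀ x : ℂ, x - p * x = (1 - p) * x by intro x; ring, norm_mul, norm_mul, ← mul_assoc]
    exact mul_le_mul_of_nonneg_right hbal.1 (norm_nonneg _)

/-- The local sign of the exponential is constant far out in the cone. -/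
lemma dichotomy_global (hu : IsEigenfunction lam u) {N : ℝ}
    (hN : ∀ z ∈ regionA₁ lam, N ≤ ‖z‖ → u z ≠ 0) :
    ∃ R, 5 ≤ R ∧ ∃ σ : ℝ, (σ = 1 ∨ σ = -1) ∧ ∀ w ∈ cone R, u (Complex.I * w ^ 2) ≠ 0 ∧
      ‖deriv u (Complex.I * w ^ 2) / (w ^ 3 * u (Complex.I * w ^ 2)) - σ‖ ≤ 1 / 2 := by
  obtain ⟨R, hR, h⟩ := hu.dichotomy hN
  refine ⟨R, hR, ?_⟩
  set p : ℂ → ℂ := fun w => deriv u (Complex.I * w ^ 2) / (w ^ 3 * u (Complex.I * w ^ 2)) with hp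
  have hpc : ContinuousOn p (cone R) := by
    apply ContinuousOn.div
    · exact (hu.differentiable_deriv.continuous.comp (by fun_prop)).continuousOn
    · exact (Continuous.mul (by fun_prop)
        (hu.entire.continuous.comp (by fun_prop))).continuousOn
    · intro w hw
      have hw0 : w ≠ 0 := by
        rintro rfl
        have := hw.2
        simp at this; linarith
      exact mul_ne_zero (pow_ne_zero _ hw0) (h w hw).1
  have hhc : ContinuousOn (fun w => ‖1 + p w‖ - ‖1 - p w‖) (cone R) :=
    (continuousOn_const.add hpc).norm.sub (continuousOn_const.sub hpc).norm
  have hsum : ∀ w, 2 ≤ ‖1 + p w‖ + ‖1 - p w‖ := by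
    intro w
    have := norm_add_le (1 + p w) (1 - p w)
    rw [show 1 + p w + (1 - p w) = 2 by ring, Complex.norm_ofNat] at this
    exact this
  by_cases hpos : ∀ w ∈ cone R, 5 * ‖1 - p w‖ < ‖1 + p w‖
  · refine ⟨1, Or.inl rfl, fun w hw => ⟨(h w hw).1, ?_⟩⟩
    have h1 := hpos w hw
    have h2 : ‖1 + p w‖ ≤ 2 + ‖1 - p w‖ := by
      have := norm_sub_le (2 : ℂ) (1 - p w)
      rw [show 2 - (1 - p w) = 1 + p w by ring, Complex.norm_ofNat] at this
      exact this
    rw [Complex.ofReal_one, norm_sub_rev]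
    linarith
  · push Not at hpos
    obtain ⟨w₀, hw₀, hneg⟩ := hpos
    have hneg' : 5 * ‖1 + p w₀‖ < ‖1 - p w₀‖ := (h w₀ hw₀).2.resolve_right (not_lt.2 hneg)
    refine ⟨-1, Or.inr rfl, fun w hw => ⟨(h w hw).1, ?_⟩⟩
    have h1 : 5 * ‖1 + p w‖ < ‖1 - p w‖ := by
      rcases (h w hw).2 with h1 | h1
      · exact h1
      · exfalso
        -- If both alternatives occurred, |1 + p| = |1 - p| somewhere in the convex cone. There
        -- neither can be five times the other, because their sum is at least 2.
        have hsub := (cone_convex R).isPreconnected.intermediate_value hw₀ hw hhc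
        obtain ⟨v, hv, hv0⟩ := hsub (show (0 : ℝ) ∈ Set.Icc _ _ from
          ⟨by linarith [norm_nonneg (1 + p w₀)], by linarith [norm_nonneg (1 - p w)]⟩)
        have hv0' : ‖1 + p v‖ - ‖1 - p v‖ = 0 := hv0
        have := hsum v
        rcases (h v hv).2 with h2 | h2 <;> linarith
    have h2 : ‖1 - p w‖ ≤ 2 + ‖1 + p w‖ := by
      have := norm_sub_le (2 : ℂ) (1 + p w)
      rw [show 2 - (1 + p w) = 1 - p w by ring, Complex.norm_ofNat] at this
      exact this
    rw [Complex.ofReal_neg, Complex.ofReal_one, sub_neg_eq_add, add_comm]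
    linarith

/-- If the logarithmic derivative of `u` has the decaying sign along a ray then `u` is bounded on
that ray. -/
lemma bounded_of_sign (hu : IsEigenfunction lam u) {c : ℂ} {σ R : ℝ} (hc : ‖c‖ ^ 2 = 17 / 16)
    (hcσ : (Complex.I * c ^ 5).re * σ ≤ -1) (hR : 0 < R)
    (h : ∀ x : ℝ, R ≤ x → u (Complex.I * (x * c) ^ 2) ≠ 0 ∧
      ‖deriv u (Complex.I * (x * c) ^ 2) / ((x * c) ^ 3 * u (Complex.I * (x * c) ^ 2)) - σ‖
        ≤ 1 / 2) :
    ∃ C, ∀ r : ℝ, 0 < r → ‖u (r * (16 / 17 * Complex.I * c ^ 2))‖ ≤ C := by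
  set b : ℂ := 16 / 17 * Complex.I * c ^ 2 with hb
  set S := 17 / 16 * R ^ 2 with hS
  have hc0 : c ≠ 0 := by rintro rfl; norm_num at hc
  have hcn : ‖c‖ ≤ 17 / 16 := by nlinarith [norm_nonneg c]
  have hanti : AntitoneOn (fun r : ℝ => ‖u (0 + r * b)‖ ^ 2) (Set.Ici S) := by
    apply antitoneOn_of_deriv_nonpos (convex_Ici S)
    · exact fun t _ => (hu.hasDerivAt_norm_sq_line 0 b t).continuousAt.continuousWithinAt
    · exact fun t _ =>
        (hu.hasDerivAt_norm_sq_line 0 b t).differentiableAt.differentiableWithinAt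
    · intro r hr
      rw [interior_Ici, Set.mem_Ioi] at hr
      rw [(hu.hasDerivAt_norm_sq_line 0 b r).deriv]
      have hr0 : 0 < r := lt_of_le_of_lt (by positivity) hr
      set x := Real.sqrt (16 / 17 * r) with hx
      have hx2 : x ^ 2 = 16 / 17 * r := Real.sq_sqrt (by positivity)
      have hx0 : 0 < x := Real.sqrt_pos.2 (by positivity)
      have hxR : R ≤ x := by
        apply Real.le_sqrt_of_sq_le
        rw [hS] at hr
        linarith
      -- With x² = 16r/17, the ray w = xc is carried to the ray rb, where b is a unit vector because
      -- |c|² = 17/16.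
      have hz : Complex.I * (x * c) ^ 2 = 0 + r * b := by
        have : (x : ℂ) ^ 2 = 16 / 17 * r := by
          rw [← Complex.ofReal_pow, hx2]; push_cast; ring
        rw [mul_pow, this, hb]; ring
      obtain ⟨h1, h2⟩ := h x hxR
      rw [hz] at h1 h2
      set z := 0 + (r : ℂ) * b with hzz
      have hxc : (x : ℂ) * c ≠ 0 := mul_ne_zero (by exact_mod_cast hx0.ne') hc0
      set p := deriv u z / ((x * c) ^ 3 * u z) with hp
      have hdu : deriv u z = (x * c) ^ 3 * p * u z := by
        rw [hp, mul_div_assoc', div_mul_eq_mul_div, mul_right_comm, mul_div_cancel_left₀]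
        exact mul_ne_zero (pow_ne_zero _ hxc) h1
      have hre : (b * deriv u z * conj (u z)).re =
          16 / 17 * x ^ 3 * (Complex.I * c ^ 5 * p).re * ‖u z‖ ^ 2 := by
        have e : b * deriv u z * conj (u z) =
            ((16 / 17 * x ^ 3 : ℝ) : ℂ) * (Complex.I * c ^ 5 * p) * ((‖u z‖ ^ 2 : ℝ) : ℂ) := by
          rw [← Complex.normSq_eq_norm_sq, ← Complex.mul_conj, hdu, hb]
          push_cast
          ring
        rw [e, Complex.re_mul_ofReal, Complex.re_ofReal_mul]
      -- The main term is at most -1, and the error p - σ contributes at most (17/16)⁵/2 < 1. So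
      -- |u|² decreases along the ray.
      have hneg : (Complex.I * c ^ 5 * p).re ≤ 0 := by
        have e : Complex.I * c ^ 5 * p = (Complex.I * c ^ 5) * (σ : ℂ) +
            Complex.I * c ^ 5 * (p - σ) := by ring
        have e2 : (Complex.I * c ^ 5 * (p - σ)).re ≤ 1 := by
          refine (Complex.re_le_norm _).trans ?_
          rw [norm_mul, norm_mul, Complex.norm_I, one_mul, norm_pow]
          calc ‖c‖ ^ 5 * ‖p - σ‖ ≤ (17 / 16) ^ 5 * (1 / 2) := by gcongr
            _ ≤ 1 := by norm_num
        rw [e, Complex.add_re, Complex.re_mul_ofReal]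
        linarith
      rw [hre]
      have : 0 ≤ 16 / 17 * x ^ 3 := by positivity
      have h3 := mul_nonneg (mul_nonneg this (neg_nonneg.2 hneg)) (sq_nonneg ‖u z‖)
      linarith
  have hcont : Continuous (fun r : ℝ => u (r * b)) :=
    hu.entire.continuous.comp (by fun_prop)
  obtain ⟨C, hC⟩ := (isCompact_Icc (a := (0 : ℝ)) (b := S)).exists_bound_of_continuousOn
    hcont.continuousOn
  refine ⟨max C ‖u (S * b)‖, fun r hr => ?_⟩
  rcases le_total r S with h | h
  · exact (hC r ⟨hr.le, h⟩).trans (le_max_left _ _)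
  · have := hanti (Set.self_mem_Ici) h h
    simp only [zero_add] at this
    exact (le_of_sq_le_sq this (norm_nonneg _)).trans (le_max_right _ _)

/-- The reflection `z ↦ -conj z` maps eigenfunctions for `lam` to eigenfunctions for
`conj lam`. -/
lemma reflect (hu : IsEigenfunction lam u) :
    IsEigenfunction (conj lam) (fun z => conj (u (-conj z))) := by
  have hd : ∀ {g : ℂ → ℂ} {g' : ℂ → ℂ}, (∀ z, HasDerivAt g (g' z) z) →
      ∀ z, HasDerivAt (fun z => conj (g (-conj z))) (-conj (g' (-conj z))) z := by
    intro g g' hg z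
    have h1 : HasDerivAt (fun w => g (-w)) (-g' (-conj z)) (conj z) := by
      have := HasDerivAt.comp (conj z) (hg (-conj z)) (hasDerivAt_neg (conj z))
      exact this.congr_deriv (by ring)
    have h2 := h1.conj_conj
    rw [Complex.conj_conj, map_neg] at h2
    exact h2
  have h1 := hd hu.hasDerivAt
  have h2 := hd hu.hasDerivAt_deriv
  have hderiv : deriv (fun z => conj (u (-conj z))) = fun z => -conj (deriv u (-conj z)) :=
    funext fun z => (h1 z).deriv
  have hpt : ∀ (r θ : ℝ), -conj ((r : ℂ) * Complex.exp (θ * Complex.I)) =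
      r * Complex.exp (((Real.pi - θ : ℝ) : ℂ) * Complex.I) := by
    intro r θ
    rw [map_mul, Complex.conj_ofReal, ← Complex.exp_conj, map_mul, Complex.conj_I,
      Complex.conj_ofReal]
    have : ((Real.pi - θ : ℝ) : ℂ) * Complex.I = Real.pi * Complex.I + θ * -Complex.I := by
      push_cast; ring
    rw [this, Complex.exp_add, Complex.exp_pi_mul_I]
    ring
  refine ⟨fun z => (h1 z).differentiableAt, ?_, ?_, ?_, ?_⟩
  · obtain ⟨z, hz⟩ := hu.ne_zero
    exact ⟨-conj z, by simpa using hz⟩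
  · intro z
    rw [hderiv, (show HasDerivAt (fun z => -conj (deriv u (-conj z))) _ z from (h2 z).neg).deriv]
    simp only [map_mul, map_sub, map_pow, map_neg, Complex.conj_I, Complex.conj_conj]
    ring
  · intro θ ha hb
    have h := hu.decay_left (Real.pi - θ)
      (by unfold criticalAngle at *; push_cast at *; linarith)
      (by unfold criticalAngle at *; push_cast at *; linarith)
    simp only [hpt]
    simpa [Function.comp_def] using (Complex.continuous_conj.tendsto _).comp h
  · intro θ ha hb
    have h := hu.decay_right (Real.pi - θ)
      (by unfold criticalAngle at *; push_cast at *; linarith)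
      (by unfold criticalAngle at *; push_cast at *; linarith)
    simp only [hpt]
    simpa [Function.comp_def] using (Complex.continuous_conj.tendsto _).comp h

end IsEigenfunction

/-- The edge w = x(1 + i/4) of the cone becomes the ray of angle π/2 + 2 arctan(1/4), about 118
degrees, within the range of `unbounded_on_ray`. -/
lemma ray_direction : ∃ θ : ℝ, 3 * Real.pi / 5 ≤ θ ∧ θ ≤ 3 * Real.pi / 4 ∧
    16 / 17 * Complex.I * (1 + Complex.I / 4) ^ 2 = Complex.exp (θ * Complex.I) := by
  set ψ := Real.arctan (1 / 4) with hψ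
  set s := Real.sqrt (1 + (1 / 4) ^ 2) with hs
  have hs2 : s ^ 2 = 17 / 16 := by rw [hs, Real.sq_sqrt (by positivity)]; norm_num
  have hs0 : 0 < s := Real.sqrt_pos.2 (by positivity)
  have hsin : Real.sin ψ = 1 / 4 / s := Real.sin_arctan _
  have hcos : Real.cos ψ = 1 / s := Real.cos_arctan _
  have hψ0 : 0 < ψ := Real.arctan_pos.2 (by norm_num)
  have h1 : 1 / 5 ≤ ψ := by
    have h2 := Real.sin_le hψ0.le
    refine le_trans ?_ h2
    rw [hsin, le_div_iff₀ hs0]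
    nlinarith
  have h2 : ψ ≤ 1 / 4 := by
    have := Real.lt_tan hψ0 (Real.arctan_lt_pi_div_two _)
    rw [hψ, Real.tan_arctan] at this
    exact this.le
  have hexp : Complex.exp (ψ * Complex.I) = (1 + Complex.I / 4) / s := by
    rw [Complex.exp_mul_I, ← Complex.ofReal_cos, ← Complex.ofReal_sin, hsin, hcos]
    push_cast
    ring
  refine ⟨Real.pi / 2 + 2 * ψ, ?_, ?_, ?_⟩
  · linarith [Real.pi_lt_d2]
  · linarith [Real.pi_gt_three]
  · have e : ((Real.pi / 2 + 2 * ψ : ℝ) : ℂ) * Complex.I =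
        Real.pi / 2 * Complex.I + (ψ * Complex.I + ψ * Complex.I) := by push_cast; ring
    have hsC : (s : ℂ) ^ 2 = 17 / 16 := by rw [← Complex.ofReal_pow, hs2]; push_cast; ring
    rw [e, Complex.exp_add, Complex.exp_add, Complex.exp_pi_div_two_mul_I, hexp,
      div_mul_div_comm, ← pow_two (s : ℂ), hsC]
    ring

/-! ### Infinitely many zeros in A₁. -/

namespace IsEigenfunction

variable {lam : ℂ} {u : ℂ → ℂ}

lemma infinite_zeros_regionA₁ (hu : IsEigenfunction lam u) :
    (zerosIn u (regionA₁ lam)).Infinite := by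
  intro hfin
  obtain ⟨N, hN⟩ := hfin.isBounded.exists_norm_le
  have hN' : ∀ z ∈ regionA₁ lam, N + 1 ≤ ‖z‖ → u z ≠ 0 := by
    intro z hz hzN h0
    have := hN z ⟨hz, by rw [h0, zero_mul]⟩
    linarith
  obtain ⟨R, hR, σ, hσ, h⟩ := hu.dichotomy_global hN'
  obtain ⟨θ, hθ1, hθ2, hθ⟩ := ray_direction
  have hmem : ∀ c : ℂ, c.re = 1 → |c.im| = 1 / 4 → ∀ x : ℝ, R ≤ x → (x : ℂ) * c ∈ cone R := by
    intro c h1 h2 x hx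
    refine ⟨?_, ?_⟩
    · rw [Complex.im_ofReal_mul, Complex.re_ofReal_mul, abs_mul, h1, h2,
        abs_of_pos (by linarith)]
      linarith
    · rw [Complex.re_ofReal_mul, h1]; linarith
  have hpow : ∀ c : ℂ, (Complex.I * c ^ 5).re =
      -(5 * c.re ^ 4 * c.im - 10 * c.re ^ 2 * c.im ^ 3 + c.im ^ 5) := by
    intro c
    simp only [pow_succ, pow_zero, one_mul, Complex.mul_re, Complex.mul_im, Complex.I_re,
      Complex.I_im]
    ring
  -- For σ = 1 the solution decreases along the left edge of the cone, for σ = -1 along the right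
  -- edge; the second case is reflected to the first.
  rcases hσ with rfl | rfl
  · obtain ⟨C, hC⟩ := hu.bounded_of_sign (c := 1 + Complex.I / 4) (σ := 1) (R := R)
      (by rw [← Complex.normSq_eq_norm_sq, Complex.normSq_apply]; norm_num)
      (by rw [hpow]; norm_num) (by linarith)
      (fun x hx => h _ (hmem _ (by simp) (by simp) x hx))
    rw [hθ] at hC
    exact hu.unbounded_on_ray hθ1 hθ2 hC
  · obtain ⟨C, hC⟩ := hu.bounded_of_sign (c := 1 - Complex.I / 4) (σ := -1) (R := R)
      (by rw [← Complex.normSq_eq_norm_sq, Complex.normSq_apply]; norm_num)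
      (by rw [hpow]; norm_num) (by linarith)
      (fun x hx => h _ (hmem _ (by simp) (by simp) x hx))
    refine hu.reflect.unbounded_on_ray (C := C) hθ1 hθ2 fun r hr => ?_
    have e : -conj ((r : ℂ) * Complex.exp (θ * Complex.I)) =
        r * (16 / 17 * Complex.I * (1 - Complex.I / 4) ^ 2) := by
      rw [← hθ]
      simp only [map_mul, map_pow, map_add, map_div₀, map_one, Complex.conj_I, Complex.conj_ofReal,
        map_ofNat]
      ring
    rw [e, Complex.norm_conj]
    exact hC r hr

end IsEigenfunction

/-! ### Monotonicity of Re(u'ū). -/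

lemma potential_re (lam z : ℂ) :
    (Complex.I * z ^ 3 - lam).re = z.im ^ 3 - 3 * z.re ^ 2 * z.im - lam.re := by
  simp only [pow_succ, pow_zero, one_mul, Complex.mul_re, Complex.mul_im, Complex.sub_re,
    Complex.I_re, Complex.I_im]
  ring

lemma potential_im (lam z : ℂ) :
    (Complex.I * z ^ 3 - lam).im = z.re ^ 3 - 3 * z.re * z.im ^ 2 - lam.im := by
  simp only [pow_succ, pow_zero, one_mul, Complex.mul_re, Complex.mul_im, Complex.sub_im,
    Complex.I_re, Complex.I_im]
  ring

namespace IsEigenfunction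

variable {lam : ℂ} {u : ℂ → ℂ}

lemma hasDerivAt_reDerivConj_horizontal (hu : IsEigenfunction lam u) (y s : ℝ) :
    HasDerivAt (fun t : ℝ => reDerivConj u (y * Complex.I + t))
      (‖deriv u (y * Complex.I + s)‖ ^ 2 +
        (y ^ 3 - 3 * s ^ 2 * y - lam.re) * ‖u (y * Complex.I + s)‖ ^ 2) s := by
  have h := hu.hasDerivAt_re_line (y * Complex.I) 1 s
  simp only [one_mul, mul_one, one_pow, norm_one, potential_re] at h
  simpa [reDerivConj] using h

/-- The term in |u'|² has a purely imaginary coefficient and drops out. On the axis iz³ is real, so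
only Im λ survives. -/
lemma hasDerivAt_reDerivConj_vertical (hu : IsEigenfunction lam u) (y : ℝ) :
    HasDerivAt (fun t : ℝ => reDerivConj u (t * Complex.I))
      (lam.im * ‖u (y * Complex.I)‖ ^ 2) y := by
  have h := hasDerivAt_re_mul_conj
    (hasDerivAt_along_line (a := 0) (b := Complex.I) (t := y) (hu.hasDerivAt_deriv _))
    (hasDerivAt_along_line (a := 0) (b := Complex.I) (t := y) (hu.hasDerivAt _))
  simp only [zero_add] at h
  refine HasDerivAt.congr_deriv (f := fun t : ℝ => reDerivConj u (t * Complex.I)) h ?_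
  have hq : Complex.I * ((y : ℂ) * Complex.I) ^ 3 - lam = ((y ^ 3 : ℝ) : ℂ) - lam := by
    rw [mul_pow]; push_cast
    linear_combination ((y : ℂ) ^ 3 * (Complex.I ^ 2 - 1)) * Complex.I_sq
  rw [hq, ← Complex.normSq_eq_norm_sq, Complex.normSq_apply]
  simp only [map_mul, Complex.conj_I, Complex.mul_re, Complex.mul_im, Complex.conj_re,
    Complex.conj_im, Complex.sub_re, Complex.sub_im, Complex.ofReal_re, Complex.ofReal_im,
    Complex.I_re, Complex.I_im, Complex.neg_re, Complex.neg_im]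
  ring

lemma reDerivConj_horizontal_mono (hu : IsEigenfunction lam u) {y a b : ℝ} (hab : a ≤ b)
    (h : ∀ s ∈ Set.Icc a b, 0 ≤ y ^ 3 - 3 * s ^ 2 * y - lam.re) :
    reDerivConj u (y * Complex.I + a) ≤ reDerivConj u (y * Complex.I + b) := by
  have hm : MonotoneOn (fun t : ℝ => reDerivConj u (y * Complex.I + t)) (Set.Icc a b) := by
    apply monotoneOn_of_deriv_nonneg (convex_Icc a b)
    · exact fun t _ =>
        (hu.hasDerivAt_reDerivConj_horizontal y t).continuousAt.continuousWithinAt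
    · exact fun t _ =>
        (hu.hasDerivAt_reDerivConj_horizontal y t).differentiableAt.differentiableWithinAt
    · intro t ht
      rw [(hu.hasDerivAt_reDerivConj_horizontal y t).deriv]
      have := h t (interior_subset ht)
      positivity
  exact hm (Set.left_mem_Icc.2 hab) (Set.right_mem_Icc.2 hab) hab

lemma reDerivConj_vertical_mono (hu : IsEigenfunction lam u) (hlam : 0 < lam.im) :
    Monotone (fun t : ℝ => reDerivConj u (t * Complex.I)) := by
  apply monotone_of_hasDerivAt_nonneg hu.hasDerivAt_reDerivConj_vertical
  intro y
  simp only [Pi.zero_apply]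
  positivity

lemma reDerivConj_vertical_strictMono (hu : IsEigenfunction lam u) (hlam : 0 < lam.im) :
    StrictMono (fun t : ℝ => reDerivConj u (t * Complex.I)) := by
  have hm := hu.reDerivConj_vertical_mono hlam
  intro s t hst
  refine lt_of_le_of_ne (hm hst.le) fun heq => ?_
  obtain ⟨x, hx, hne⟩ := hu.exists_ne_zero_on_line 0 Complex.I_ne_zero hst
  have hc : (fun t : ℝ => reDerivConj u (t * Complex.I)) =ᶠ[𝓝 x]
      fun _ => reDerivConj u (s * Complex.I) := by
    filter_upwards [Ioo_mem_nhds hx.1 hx.2] with r hr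
    exact le_antisymm ((hm hr.2.le).trans heq.ge) (hm hr.1.le)
  have h1 := hc.deriv_eq
  rw [(hu.hasDerivAt_reDerivConj_vertical x).deriv, deriv_const] at h1
  rw [zero_add] at hne
  have : 0 < ‖u (x * Complex.I)‖ := norm_pos_iff.2 hne
  have : 0 < lam.im * ‖u (x * Complex.I)‖ ^ 2 := by positivity
  linarith

end IsEigenfunction

/-! ### Energy estimates near the imaginary axis. -/

lemma energy_quadratic_bound {a b C κ y : ℝ} (hκ : 0 < κ)
    (hy : C ^ 2 ≤ 4 * κ ^ 2 * y) : C * y * (a * b) ≤ κ * (b ^ 2 + y ^ 3 * a ^ 2) := by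
  have h1 : 0 ≤ (2 * κ * b - C * y * a) ^ 2 := sq_nonneg _
  have h2 : C ^ 2 * (y ^ 2 * a ^ 2) ≤ 4 * κ ^ 2 * y * (y ^ 2 * a ^ 2) :=
    mul_le_mul_of_nonneg_right hy (by positivity)
  have h3 : 0 ≤ 4 * κ * (κ * (b ^ 2 + y ^ 3 * a ^ 2) - C * y * (a * b)) := by nlinarith
  have h4 := nonneg_of_mul_nonneg_right h3 (by positivity)
  linarith

namespace IsEigenfunction

variable {lam : ℂ} {u : ℂ → ℂ}

/-- The energy on the imaginary axis grows slower than `y²`. -/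
lemma energy_bound (hu : IsEigenfunction lam u) :
    ∃ K Y : ℝ, 0 ≤ K ∧ 1 ≤ Y ∧ ∀ y : ℝ, Y ≤ y →
      ‖deriv u (y * Complex.I)‖ ^ 2 + y ^ 3 * ‖u (y * Complex.I)‖ ^ 2 ≤ K * y ^ (7 / 4 : ℝ) := by
  set C := 5 + 2 * ‖lam‖ with hC
  have hC0 : 5 ≤ C := by have := norm_nonneg lam; linarith
  -- This makes C² ≤ 4(1/16)²y, the hypothesis of `energy_quadratic_bound` with κ = 1/16.
  set Y := 64 * C ^ 2 with hY
  have hY2 : 2 ≤ Y := by nlinarith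
  set m : ℝ → ℝ := fun y => ‖u (y * Complex.I)‖ ^ 2 with hm
  set d : ℝ → ℝ := fun y => ‖deriv u (y * Complex.I)‖ ^ 2 with hd
  set H : ℝ → ℝ := fun y => (Complex.I * deriv u (y * Complex.I) * conj (u (y * Complex.I))).re
    with hH
  set L : ℝ → ℝ := fun y => (Complex.I * lam * u (y * Complex.I) *
    conj (deriv u (y * Complex.I))).re with hL
  have hq : ∀ y : ℝ, Complex.I * ((y : ℂ) * Complex.I) ^ 3 - lam = ((y ^ 3 : ℝ) : ℂ) - lam := by
    intro y
    rw [mul_pow]; push_cast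
    linear_combination ((y : ℂ) ^ 3 * (Complex.I ^ 2 - 1)) * Complex.I_sq
  have hmd : ∀ y, HasDerivAt m (2 * H y) y := by
    intro y
    simpa only [zero_add] using hu.hasDerivAt_norm_sq_line 0 Complex.I y
  have hHd : ∀ y, HasDerivAt H (d y - (y ^ 3 - lam.re) * m y) y := by
    intro y
    have h := hu.hasDerivAt_re_line 0 Complex.I y
    simp only [zero_add, hq] at h
    refine h.congr_deriv ?_
    simp only [Complex.I_sq, Complex.norm_I, one_pow, one_mul, neg_mul, Complex.neg_re,
      Complex.sub_re, Complex.ofReal_re, hd, hm]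
    ring
  have hdd : ∀ y, HasDerivAt d (-2 * y ^ 3 * H y - 2 * L y) y := by
    intro y
    have h := hasDerivAt_norm_sq
      (hasDerivAt_along_line (a := 0) (b := Complex.I) (t := y) (hu.hasDerivAt_deriv _))
    simp only [zero_add, hq] at h
    refine h.congr_deriv ?_
    simp only [hH, hL, Complex.mul_re, Complex.mul_im, Complex.conj_re, Complex.conj_im,
      Complex.sub_re, Complex.sub_im, Complex.ofReal_re, Complex.ofReal_im, Complex.I_re,
      Complex.I_im]
    ring
  have hHb : ∀ y, |H y| ≤ ‖u (y * Complex.I)‖ * ‖deriv u (y * Complex.I)‖ := by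
    intro y
    refine (re_mul_conj_le _ _).trans (le_of_eq ?_)
    rw [norm_mul, Complex.norm_I, one_mul, mul_comm]
  have hLb : ∀ y, |L y| ≤ ‖lam‖ * (‖u (y * Complex.I)‖ * ‖deriv u (y * Complex.I)‖) := by
    intro y
    refine (re_mul_conj_le _ _).trans (le_of_eq ?_)
    rw [norm_mul, norm_mul, Complex.norm_I, one_mul, mul_assoc]
  -- The raw energy has derivative 3y²|u|² - 2L, which alone would only give growth y³. The
  -- correction (3/2)H/y averages kinetic and potential parts, so the main part of G' is 3/2 times
  -- the energy over y. The exponent 7/4 lies above 3/2, absorbing the errors, and below 2, as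
  -- needed later.
  set G : ℝ → ℝ := fun y => d y + y ^ 3 * m y + 3 / 2 * (y⁻¹ * H y) with hG
  have hGd : ∀ y, 0 < y → HasDerivAt G (3 / 2 * (y⁻¹ * (d y + y ^ 3 * m y)) - 2 * L y +
      3 / 2 * (lam.re * (y⁻¹ * m y)) - 3 / 2 * ((y ^ 2)⁻¹ * H y)) y := by
    intro y hy
    have h := ((hdd y).add ((hasDerivAt_pow 3 y).mul (hmd y))).add
      (((hasDerivAt_inv hy.ne').mul (hHd y)).const_mul (3 / 2))
    refine HasDerivAt.congr_deriv (f := G) h ?_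
    push_cast
    field_simp
    ring
  have hrp : ∀ y : ℝ, 0 < y → HasDerivAt (fun y : ℝ => y ^ (-(7 / 4) : ℝ))
      (-(7 / 4) * (y⁻¹ * y ^ (-(7 / 4) : ℝ))) y := by
    intro y hy
    refine (Real.hasDerivAt_rpow_const (p := -(7 / 4)) (Or.inl hy.ne')).congr_deriv ?_
    rw [Real.rpow_sub_one hy.ne']
    ring
  have hGlow : ∀ y, Y ≤ y → (d y + y ^ 3 * m y) / 2 ≤ G y := by
    intro y hy
    have hy0 : 0 < y := by linarith
    have h1 := energy_quadratic_bound (a := ‖u (y * Complex.I)‖) (b := ‖deriv u (y * Complex.I)‖)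
      (C := 3 / 2) (κ := 1 / 2) (y := y) (by norm_num) (by nlinarith)
    have h2 := (abs_le.1 (hHb y)).1
    have h3 : 3 / 2 * (‖u (y * Complex.I)‖ * ‖deriv u (y * Complex.I)‖) ≤
        1 / 2 * (d y + y ^ 3 * m y) := by
      refine le_trans ?_ h1
      have : 0 ≤ ‖u (y * Complex.I)‖ * ‖deriv u (y * Complex.I)‖ := by positivity
      nlinarith
    have h4 : -(3 / 2 * (‖u (y * Complex.I)‖ * ‖deriv u (y * Complex.I)‖)) ≤
        3 / 2 * (y⁻¹ * H y) := by
      have hy1 : y⁻¹ ≤ 1 := inv_le_one_of_one_le₀ (by linarith)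
      have hyp : 0 < y⁻¹ := inv_pos.2 hy0
      have : 0 ≤ ‖u (y * Complex.I)‖ * ‖deriv u (y * Complex.I)‖ := by positivity
      nlinarith
    simp only [hG]
    linarith
  have hbr : ∀ y, Y ≤ y → -(7 / 4) * (y⁻¹ * G y) + (3 / 2 * (y⁻¹ * (d y + y ^ 3 * m y)) -
      2 * L y + 3 / 2 * (lam.re * (y⁻¹ * m y)) - 3 / 2 * ((y ^ 2)⁻¹ * H y)) ≤ 0 := by
    intro y hy
    have hy0 : 0 < y := by linarith
    have hy1 : 1 ≤ y := by linarith
    set P := ‖u (y * Complex.I)‖ * ‖deriv u (y * Complex.I)‖ with hP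
    have hP0 : 0 ≤ P := by positivity
    have k1 : C * y * P ≤ 1 / 16 * (d y + y ^ 3 * m y) :=
      energy_quadratic_bound (κ := 1 / 16) (by norm_num) (by rw [hY] at hy; linarith)
    have k2 := (abs_le.1 (hHb y)).1
    have k3 := (abs_le.1 (hLb y)).1
    have k4 : lam.re * m y ≤ 1 / 24 * (y ^ 3 * m y) := by
      have hlr : lam.re ≤ 1 / 24 * y ^ 3 := by
        have a1 : lam.re ≤ ‖lam‖ := Complex.re_le_norm lam
        have a2 : y ≤ y ^ 3 := by
          calc y = y ^ 1 := (pow_one y).symm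
            _ ≤ y ^ 3 := pow_le_pow_right₀ hy1 (by norm_num)
        have a3 : 24 * ‖lam‖ ≤ y := by nlinarith [norm_nonneg lam]
        linarith
      have := mul_le_mul_of_nonneg_right hlr (show 0 ≤ m y by simp only [hm]; positivity)
      linarith
    have hd0 : 0 ≤ d y := by simp only [hd]; positivity
    have hm0 : 0 ≤ y ^ 3 * m y := by simp only [hm]; positivity
    have e : -(7 / 4) * (y⁻¹ * G y) + (3 / 2 * (y⁻¹ * (d y + y ^ 3 * m y)) -
      2 * L y + 3 / 2 * (lam.re * (y⁻¹ * m y)) - 3 / 2 * ((y ^ 2)⁻¹ * H y)) =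
      y⁻¹ * (-(1 / 4) * (d y + y ^ 3 * m y) - 33 / 8 * (y⁻¹ * H y) + 3 / 2 * (lam.re * m y) -
        2 * (y * L y)) := by
      simp only [hG]
      field_simp
      ring
    rw [e]
    apply mul_nonpos_of_nonneg_of_nonpos (by positivity)
    have k5 : -(y * P) ≤ y⁻¹ * H y := by
      have hyi : y⁻¹ ≤ 1 := inv_le_one_of_one_le₀ hy1
      have hyp : 0 < y⁻¹ := inv_pos.2 hy0
      nlinarith
    have k6 : -(‖lam‖ * (y * P)) ≤ y * L y := by nlinarith
    have k7 : 5 * (y * P) + 2 * (‖lam‖ * (y * P)) ≤ 1 / 16 * (d y + y ^ 3 * m y) := by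
      rw [hC] at k1; linarith
    have k8 : 0 ≤ y * P := by positivity
    linarith
  have hanti : AntitoneOn (fun y : ℝ => y ^ (-(7 / 4) : ℝ) * G y) (Set.Ici Y) := by
    have hder : ∀ y, 0 < y → HasDerivAt (fun y : ℝ => y ^ (-(7 / 4) : ℝ) * G y) _ y :=
      fun y hy => (hrp y hy).mul (hGd y hy)
    apply antitoneOn_of_deriv_nonpos (convex_Ici Y)
    · exact fun t ht => (hder t (by have : Y ≤ t := ht; linarith)).continuousAt.continuousWithinAt
    · intro t ht
      have ht' : Y ≤ t := interior_subset ht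
      exact (hder t (by linarith)).differentiableAt.differentiableWithinAt
    · intro t ht
      have ht' : Y ≤ t := interior_subset ht
      have ht0 : 0 < t := by linarith
      rw [(hder t ht0).deriv]
      have h1 : 0 ≤ t ^ (-(7 / 4) : ℝ) := (Real.rpow_pos_of_pos ht0 _).le
      have h2 := mul_nonpos_of_nonneg_of_nonpos h1 (hbr t ht')
      linarith
  refine ⟨2 * (Y ^ (-(7 / 4) : ℝ) * G Y), Y, ?_, by linarith, fun y hy => ?_⟩
  · have h1 : 0 ≤ G Y := le_trans (by simp only [hd, hm]; positivity) (hGlow Y le_rfl)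
    positivity
  · have h1 := hanti (Set.self_mem_Ici) hy hy
    have hy0 : 0 < y := by linarith
    have h2 := hGlow y hy
    have h3 : 0 < y ^ (7 / 4 : ℝ) := Real.rpow_pos_of_pos hy0 _
    have h4 : y ^ (7 / 4 : ℝ) * y ^ (-(7 / 4) : ℝ) = 1 := by
      rw [← Real.rpow_add hy0]; norm_num
    have h5 : G y ≤ y ^ (7 / 4 : ℝ) * (Y ^ (-(7 / 4) : ℝ) * G Y) := by
      calc G y = y ^ (7 / 4 : ℝ) * (y ^ (-(7 / 4) : ℝ) * G y) := by rw [← mul_assoc, h4, one_mul]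
        _ ≤ _ := mul_le_mul_of_nonneg_left h1 h3.le
    have h6 : (d y + y ^ 3 * m y) / 2 ≤ y ^ (7 / 4 : ℝ) * (Y ^ (-(7 / 4) : ℝ) * G Y) := h2.trans h5
    simp only [hd, hm] at h6
    linarith

/-- The energy changes by a bounded factor over horizontal distance `β / y²`. -/
lemma horizontal_energy_bound (hu : IsEigenfunction lam u) {β y t : ℝ} (hy1 : 1 ≤ y)
    (hlam : ‖lam‖ ≤ y) (hβ : β ≤ y) (ht0 : 0 ≤ t) (ht : t ≤ β / y ^ 2) :
    ‖deriv u (y * Complex.I - t)‖ ^ 2 + y ^ 3 * ‖u (y * Complex.I - t)‖ ^ 2 ≤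
      (‖deriv u (y * Complex.I)‖ ^ 2 + y ^ 3 * ‖u (y * Complex.I)‖ ^ 2) *
        Real.exp (10 * β) := by
  have hy0 : 0 < y := by linarith
  have hty : t * y ^ 2 ≤ β := (le_div_iff₀ (by positivity)).1 ht
  have hM : ∀ s : ℝ, HasDerivAt (fun s : ℝ => ‖deriv u (y * Complex.I + s * (-1))‖ ^ 2 +
      y ^ 3 * ‖u (y * Complex.I + s * (-1))‖ ^ 2) _ s := fun s =>
    (hasDerivAt_norm_sq (hasDerivAt_along_line (hu.hasDerivAt_deriv _))).add
      ((hu.hasDerivAt_norm_sq_line (y * Complex.I) (-1) s).const_mul (y ^ 3))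
  -- The potential is at most 9y³, so the derivative is at most 20y³|u||u'|, and 2y|u||u'| is at
  -- most the energy: rate 10y². Over a length β/y² this gives the factor exp(10β).
  have hφ : ∀ s : ℝ, HasDerivAt (fun s : ℝ => 10 * y ^ 2 * s) (10 * y ^ 2) s := fun s => by
    simpa using (hasDerivAt_id s).const_mul (10 * y ^ 2)
  have key := le_mul_exp_of_deriv_le ht0 (fun s _ => hM s) (fun s _ => hφ s) ?_
  · simp only [mul_neg, mul_one, ← sub_eq_add_neg, Complex.ofReal_zero, sub_zero, mul_zero] at key
    refine key.trans ?_
    exact mul_le_mul_of_nonneg_left (Real.exp_le_exp.2 (by linarith)) (by positivity)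
  · intro s hs
    set z := (y : ℂ) * Complex.I + s * (-1) with hz
    set q := Complex.I * z ^ 3 - lam with hq
    have hzn : ‖z‖ ≤ 2 * y := by
      have h1 : s ≤ y := by
        have : t ≤ t * y ^ 2 := le_mul_of_one_le_right ht0 (one_le_pow₀ hy1)
        linarith [hs.2]
      refine (norm_add_le _ _).trans ?_
      simp [abs_of_nonneg hs.1, abs_of_pos hy0]
      linarith
    have hy3 : y ≤ y ^ 3 := by
      calc y = y ^ 1 := (pow_one y).symm
        _ ≤ y ^ 3 := pow_le_pow_right₀ hy1 (by norm_num)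
    have hqn : ‖q‖ ≤ 9 * y ^ 3 := by
      refine (norm_sub_le _ _).trans ?_
      rw [norm_mul, Complex.norm_I, one_mul, norm_pow]
      have : ‖z‖ ^ 3 ≤ (2 * y) ^ 3 := pow_le_pow_left₀ (norm_nonneg _) hzn 3
      linarith
    have e1 : (-1 * (q * u z) * conj (deriv u z)).re ≤ 9 * y ^ 3 * (‖u z‖ * ‖deriv u z‖) := by
      refine (le_abs_self _).trans ((re_mul_conj_le _ _).trans ?_)
      rw [norm_mul, norm_mul, norm_neg, norm_one, one_mul, mul_assoc]
      gcongr
    have e2 : (-1 * deriv u z * conj (u z)).re ≤ ‖u z‖ * ‖deriv u z‖ := by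
      refine (le_abs_self _).trans ((re_mul_conj_le _ _).trans ?_)
      rw [norm_mul, norm_neg, norm_one, one_mul, mul_comm]
    have e3 : 2 * y * (‖u z‖ * ‖deriv u z‖) ≤ 1 * (‖deriv u z‖ ^ 2 + y ^ 3 * ‖u z‖ ^ 2) :=
      energy_quadratic_bound (by norm_num) (by linarith)
    have e4 := mul_le_mul_of_nonneg_left e3 (by positivity : 0 ≤ 10 * y ^ 2)
    have e5 := mul_le_mul_of_nonneg_left e2 (by positivity : 0 ≤ 2 * y ^ 3)
    linarith

/-- The horizontal derivative of Re(u'ū) is at most the energy, O(y^(7/4)), and the distance is at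
most β/y². The total drop is thus O(y^(-1/4)), below δ for large y. -/
lemma reDerivConj_pos_near_axis (hu : IsEigenfunction lam u) (hre : 0 ≤ lam.re) {δ β : ℝ}
    (hδ : 0 < δ) (hβ0 : 0 ≤ β) :
    ∃ Y : ℝ, 1 ≤ Y ∧ ∀ y t : ℝ, Y ≤ y → 0 ≤ t → t ≤ β / y ^ 2 →
      δ ≤ reDerivConj u (y * Complex.I) → 0 < reDerivConj u (y * Complex.I - t) := by
  obtain ⟨K, Y, hK, hY1, hE⟩ := hu.energy_bound
  set Q := K * Real.exp (10 * β) * β with hQ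
  have hQ0 : 0 ≤ Q := by positivity
  refine ⟨max (max Y ‖lam‖) (max β (((Q + 1) / δ) ^ 4)), ?_, ?_⟩
  · exact hY1.trans ((le_max_left _ _).trans (le_max_left _ _))
  intro y t hy ht0 ht hg
  have hyY : Y ≤ y := ((le_max_left _ _).trans (le_max_left _ _)).trans hy
  have hylam : ‖lam‖ ≤ y := ((le_max_right _ _).trans (le_max_left _ _)).trans hy
  have hyβ : β ≤ y := ((le_max_left _ _).trans (le_max_right _ _)).trans hy
  have hyQ : ((Q + 1) / δ) ^ 4 ≤ y := ((le_max_right _ _).trans (le_max_right _ _)).trans hy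
  have hy1 : 1 ≤ y := by linarith
  have hy0 : 0 < y := by linarith
  set M := K * y ^ (7 / 4 : ℝ) * Real.exp (10 * β) with hM
  have hder : ∀ s : ℝ, HasDerivAt (fun s : ℝ => -reDerivConj u (y * Complex.I - s) - M * s)
      (‖deriv u (y * Complex.I - s)‖ ^ 2 +
        (y ^ 3 - 3 * s ^ 2 * y - lam.re) * ‖u (y * Complex.I - s)‖ ^ 2 - M) s := by
    intro s
    have h := (hu.hasDerivAt_re_line (y * Complex.I) (-1) s).sub ((hasDerivAt_id s).const_mul M)
    have h' := h.congr_deriv (g' := ‖deriv u (y * Complex.I - s)‖ ^ 2 +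
        (y ^ 3 - 3 * s ^ 2 * y - lam.re) * ‖u (y * Complex.I - s)‖ ^ 2 - M) (by
      rw [neg_one_sq, one_mul, potential_re]
      simp [← sub_eq_add_neg])
    refine h'.congr_of_eventuallyEq (Eventually.of_forall fun r => ?_)
    simp [reDerivConj, ← sub_eq_add_neg]
  have hanti : AntitoneOn (fun s : ℝ => -reDerivConj u (y * Complex.I - s) - M * s)
      (Set.Icc 0 t) := by
    apply antitoneOn_of_deriv_nonpos (convex_Icc 0 t)
    · exact fun s _ => (hder s).continuousAt.continuousWithinAt
    · exact fun s _ => (hder s).differentiableAt.differentiableWithinAt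
    · intro s hs
      have hs' := interior_subset hs
      rw [(hder s).deriv]
      have h1 := hu.horizontal_energy_bound hy1 hylam hyβ hs'.1 (hs'.2.trans ht)
      have h2 := mul_le_mul_of_nonneg_right (hE y hyY) (Real.exp_pos (10 * β)).le
      have h3 : 0 ≤ (3 * s ^ 2 * y + lam.re) * ‖u (y * Complex.I - s)‖ ^ 2 := by positivity
      linarith
  have h1 := hanti (Set.left_mem_Icc.2 ht0) (Set.right_mem_Icc.2 ht0) ht0
  simp only [Complex.ofReal_zero, sub_zero, mul_zero] at h1
  have hMt : M * t < δ := by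
    have e1 : M * t ≤ Q * (y ^ (7 / 4 : ℝ) / y ^ 2) := by
      calc M * t ≤ M * (β / y ^ 2) := by gcongr
        _ = Q * (y ^ (7 / 4 : ℝ) / y ^ 2) := by rw [hM, hQ]; ring
    have e2 : y ^ (7 / 4 : ℝ) / y ^ 2 = (y ^ (1 / 4 : ℝ))⁻¹ := by
      rw [← Real.rpow_natCast, ← Real.rpow_sub hy0, ← Real.rpow_neg hy0.le]
      norm_num
    have e3 : (Q + 1) / δ ≤ y ^ (1 / 4 : ℝ) := by
      have h := Real.rpow_le_rpow (by positivity) hyQ (by norm_num : (0 : ℝ) ≤ 1 / 4)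
      have e : (((Q + 1) / δ) ^ 4) ^ (1 / 4 : ℝ) = (Q + 1) / δ := by
        rw [← Real.rpow_natCast, ← Real.rpow_mul (by positivity)]
        norm_num
      rwa [e] at h
    rw [div_le_iff₀ hδ] at e3
    have h4 : 0 < y ^ (1 / 4 : ℝ) := Real.rpow_pos_of_pos hy0 _
    rw [e2, ← div_eq_mul_inv] at e1
    refine lt_of_le_of_lt e1 ?_
    rw [div_lt_iff₀ h4]
    linarith
  linarith

/-! ### Location of the zeros. -/

lemma reDerivConj_eq_zero_of_mem_zerosIn {S : Set ℂ} {z : ℂ} (hz : z ∈ zerosIn u S) :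
    reDerivConj u z = 0 := by
  rcases mul_eq_zero.1 hz.2 with h | h <;> simp [reDerivConj, h]

lemma finite_zeros_compl (hu : IsEigenfunction lam u) (hlam : 0 < lam.im) {y₀ : ℝ}
    (hy₀ : 0 ≤ reDerivConj u (y₀ * Complex.I)) :
    (zerosIn u (regionA₁ lam ∩ (regionB₂ lam)ᶜ)).Finite := by
  have hre := hu.re_pos
  -- One unit above y₀, strict monotonicity turns a nonnegative value into a positive one that
  -- persists upwards.
  set δ := reDerivConj u (((y₀ + 1 : ℝ) : ℂ) * Complex.I) with hδ
  have hδ0 : 0 < δ :=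
    lt_of_le_of_lt hy₀ (hu.reDerivConj_vertical_strictMono hlam (lt_add_one y₀))
  obtain ⟨Y, hY1, hY⟩ := hu.reDerivConj_pos_near_axis hre.le hδ0 hlam.le
  set T := max Y (y₀ + 1) with hT
  have hbd : ∀ z ∈ zerosIn u (regionA₁ lam ∩ (regionB₂ lam)ᶜ), z.im ≤ T := by
    intro z hz
    by_contra! hzT
    have h0 := reDerivConj_eq_zero_of_mem_zerosIn hz
    obtain ⟨⟨⟨him, hA⟩, hB⟩, -⟩ := hz
    rw [potential_re] at hA
    have hzY : Y ≤ z.im := (le_max_left _ _).trans hzT.le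
    have hgy : δ ≤ reDerivConj u (z.im * Complex.I) :=
      hu.reDerivConj_vertical_mono hlam ((le_max_right _ _).trans hzT.le)
    have hzz : z = z.im * Complex.I + z.re := by rw [add_comm, Complex.re_add_im]
    rcases le_or_gt 0 z.re with hx | hx
    · have := hu.reDerivConj_horizontal_mono (y := z.im) hx (fun s hs => by
        have : s ^ 2 ≤ z.re ^ 2 := pow_le_pow_left₀ hs.1 hs.2 2
        nlinarith)
      rw [← hzz, Complex.ofReal_zero, add_zero] at this
      linarith
    · have hBim : (Complex.I * z ^ 3 - lam).im ≤ 0 := by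
        by_contra! h
        exact hB ⟨hx, him, h⟩
      rw [potential_im] at hBim
      have h3 : 3 * z.re ^ 2 < z.im ^ 2 := by
        by_contra! h
        nlinarith
      -- Outside B₂, |x|(3y² - x²) ≤ Im λ, while in A₁ one has 3x² < y², so 3y² - x² ≥ y².
      have ht : -z.re ≤ lam.im / z.im ^ 2 := by
        rw [le_div_iff₀ (by positivity)]
        nlinarith
      have := hY z.im (-z.re) hzY (by linarith) ht hgy
      rw [Complex.ofReal_neg, sub_neg_eq_add, ← hzz] at this
      linarith
  have hT0 : 0 ≤ T := by linarith [le_max_left Y (y₀ + 1)]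
  -- In A₁ one has |Re z| ≤ Im z, so a bound on the height bounds the zeros.
  have hsub : zerosIn u (regionA₁ lam ∩ (regionB₂ lam)ᶜ) ⊆
      zerosIn u (Metric.closedBall 0 (2 * T)) := by
    intro z hz
    refine ⟨?_, hz.2⟩
    have hzT := hbd z hz
    obtain ⟨⟨⟨him, hA⟩, -⟩, -⟩ := hz
    rw [potential_re] at hA
    have h3 : 3 * z.re ^ 2 < z.im ^ 2 := by
      by_contra! h
      nlinarith
    have h4 : |z.re| ≤ |z.im| := sq_le_sq.1 (by nlinarith [sq_nonneg z.re])
    rw [abs_of_pos him] at h4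
    rw [mem_closedBall_zero_iff]
    have := Complex.norm_le_abs_re_add_abs_im z
    rw [abs_of_pos him] at this
    linarith
  exact (hu.finite_zerosIn_of_bounded Metric.isBounded_closedBall).subset hsub

lemma zeros_left_empty (hu : IsEigenfunction lam u)
    (h : ∀ y : ℝ, reDerivConj u (y * Complex.I) < 0) :
    zerosIn u {z | z ∈ regionA₁ lam ∧ z.re ≤ 0} = ∅ := by
  rw [Set.eq_empty_iff_forall_notMem]
  intro z hz
  have h0 := reDerivConj_eq_zero_of_mem_zerosIn hz
  obtain ⟨⟨⟨him, hA⟩, hx⟩, -⟩ := hz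
  rw [potential_re] at hA
  have hzz : z = z.im * Complex.I + z.re := by rw [add_comm, Complex.re_add_im]
  have := hu.reDerivConj_horizontal_mono (y := z.im) hx (fun s hs => by
    have : s ^ 2 ≤ z.re ^ 2 := by nlinarith [hs.1, hs.2]
    nlinarith)
  rw [← hzz, Complex.ofReal_zero, add_zero] at this
  linarith [h z.im]

end IsEigenfunction

end CubicOscillator

end

theorem theorem3p9 (lam : ℂ) (u : ℂ → ℂ)
    (hu : CubicOscillator.IsEigenfunction lam u) (hlam : 0 < lam.im) :
    ((∃ y : ℝ, 0 ≤ CubicOscillator.reDerivConj u ((y : ℂ) * Complex.I)) ↔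
      ((CubicOscillator.zerosIn u
          (CubicOscillator.regionA₁ lam ∩ CubicOscillator.regionB₂ lam)).Infinite ∧
        (CubicOscillator.zerosIn u
          (CubicOscillator.regionA₁ lam ∩ (CubicOscillator.regionB₂ lam)ᶜ)).Finite)) ∧
    ((∀ y : ℝ, CubicOscillator.reDerivConj u ((y : ℂ) * Complex.I) < 0) ↔
      (CubicOscillator.zerosIn u {z | z ∈ CubicOscillator.regionA₁ lam ∧ z.re ≤ 0} = ∅ ∧
        (CubicOscillator.zerosIn u
          {z | z ∈ CubicOscillator.regionA₁ lam ∧ 0 < z.re}).Infinite)) := by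
  have hinf := hu.infinite_zeros_regionA₁
  have hleft : CubicOscillator.zerosIn u
      (CubicOscillator.regionA₁ lam ∩ CubicOscillator.regionB₂ lam) ⊆
      CubicOscillator.zerosIn u {z | z ∈ CubicOscillator.regionA₁ lam ∧ z.re ≤ 0} :=
    fun z hz => ⟨⟨hz.1.1, hz.1.2.1.le⟩, hz.2⟩
  -- This implication and `zeros_left_empty` settle both converses as well: the two sign conditions
  -- are complementary, and zeros in A₁ ∩ B₂ lie in Re z < 0.
  have hfwd : (∃ y : ℝ, 0 ≤ CubicOscillator.reDerivConj u ((y : ℂ) * Complex.I)) →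
      ((CubicOscillator.zerosIn u
          (CubicOscillator.regionA₁ lam ∩ CubicOscillator.regionB₂ lam)).Infinite ∧
        (CubicOscillator.zerosIn u
          (CubicOscillator.regionA₁ lam ∩ (CubicOscillator.regionB₂ lam)ᶜ)).Finite) := by
    rintro ⟨y, hy⟩
    have hfin := hu.finite_zeros_compl hlam hy
    refine ⟨fun hfin' => hinf ((hfin'.union hfin).subset fun z hz => ?_), hfin⟩
    by_cases hB : z ∈ CubicOscillator.regionB₂ lam
    · exact Or.inl ⟨⟨hz.1, hB⟩, hz.2⟩
    · exact Or.inr ⟨⟨hz.1, hB⟩, hz.2⟩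
  refine ⟨⟨hfwd, fun h => ?_⟩, fun h => ?_, fun h => ?_⟩
  · by_contra! hneg
    exact h.1 (by
      rw [Set.subset_eq_empty hleft (hu.zeros_left_empty hneg)]
      exact Set.finite_empty)
  · have hempty := hu.zeros_left_empty h
    refine ⟨hempty, fun hfin => hinf (hfin.subset fun z hz => ⟨⟨hz.1, ?_⟩, hz.2⟩)⟩
    by_contra! hx
    exact Set.notMem_empty z (hempty ▸ (⟨⟨hz.1, hx⟩, hz.2⟩ :
      z ∈ CubicOscillator.zerosIn u {z | z ∈ CubicOscillator.regionA₁ lam ∧ z.re ≤ 0}))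
  · by_contra! hpos
    exact (hfwd hpos).1 (by
      rw [Set.subset_eq_empty hleft h.1]
      exact Set.finite_empty)
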